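/- Let $\mathbb D$ be the open unit disk and $\mathbb T=\partial\mathbb D$. For a bounded analytic function $b$ on $\mathbb D$ with $\|b\|_{H^\infty}=\sup_{\mathbb D}|b|\le 1$, let $H(b)$ be the de Branges–Rovnyak space, i.e. the reproducing kernel Hilbert space on $\mathbb D$ with kernel \[k^b(z,\omega)=\frac{1-\overline{b(\omega)}\,b(z)}{1-\overline{\omega}z},\qquad z,\omega\in\mathbb D,\] and let $\sigma(b)=\{\lambda\in\mathbb T:\ \liminf_{z\to\lambda,\,z\in\mathbb D}|b(z)|<1\}$ be the boundary spectrum of $b$. For $\zeta\in\mathbb T$, let $\mathcal D_\zeta$ be the local Dirichlet space of all $f$ holomorphic on $\mathbb D$ with \[D_\zeta(f)=\frac1\pi\int_{\mathbb D}|f'(z)|^2\,\frac{1-|z|^2}{|z-\zeta|^2}\,dA(z)<\infty,\] equipped with the norm $\|f\|^2=\|f\|_{H^2}^2+D_\zeta(f)$. The embedding $X\hookrightarrow\mathcal D_\zeta$ means that $X\subseteq\mathcal D_\zeta$ and that the inclusion is bounded. Let $\zeta\in\mathbb T$. (1) Let $b$ be analytic on $\mathbb D$ with $\|b\|_{H^\infty}=1$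 and assume that $\sigma(b)$ is closed. Then $H(b)\hookrightarrow\mathcal D_\zeta$ if and only if $\zeta\notin\sigma(b)$. (2) In particular, let $u$ be an inner function (a bounded analytic function on $\mathbb D$ whose radial boundary values have modulus $1$ almost everywhere on $\mathbb T$), and let $K_u=H^2\ominus uH^2$ be its model space, with the norm of $H^2$. Then $K_u\hookrightarrow\mathcal D_\zeta$ if and only if $\zeta\notin\sigma(u)$. -/

import Mathlib

open scoped ComplexConjugate ENNReal NNReal Topology

noncomputable section

namespace LocalDirichlet

/-! ### Analytic functions on the unit disk

A function on the open unit disk is represented by a function `ℂ → ℂ`; its values outside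
`Metric.ball 0 1` play no role. -/

/-- `f` is holomorphic on the open unit disk. -/
def IsHol (f : ℂ → ℂ) : Prop := DifferentiableOn ℂ f (Metric.ball 0 1)

/-- The supremum norm `‖b‖_{H^∞}` over the unit disk, with values in `[0, ∞]`. -/
def hInftyNorm (b : ℂ → ℂ) : ℝ≥0∞ := ⨆ z ∈ Metric.ball (0 : ℂ) 1, ‖b z‖ₑ

/-- The boundary spectrum `σ(b) = {λ ∈ 𝕋 : liminf_{z → λ, |z| < 1} |b z| < 1}`. -/
def boundarySpectrum (b : ℂ → ℂ) : Set ℂ :=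
  {l | ‖l‖ = 1 ∧ Filter.liminf (fun z => ‖b z‖ₑ) (𝓝[Metric.ball 0 1] l) < 1}

/-- An inner function: bounded and holomorphic on the disk, with unimodular radial boundary
values almost everywhere on the unit circle. -/
structure IsInner (u : ℂ → ℂ) : Prop where
  isHol : IsHol u
  bounded : hInftyNorm u < ∞
  unimodular : ∀ᵐ θ : ℝ, ∃ l : ℂ, ‖l‖ = 1 ∧
    Filter.Tendsto (fun r : ℝ => u (r * Complex.exp (θ * Complex.I))) (𝓝[<] 1) (𝓝 l)

/-! ### The Hardy space `H²` -/

/-- The `n`-th Taylor coefficient of `f` at the origin. -/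
def taylorCoeff (f : ℂ → ℂ) (n : ℕ) : ℂ := iteratedDeriv n f 0 / (n.factorial : ℂ)

/-- The squared Hardy norm `‖f‖²_{H²} = ∑ |aₙ|²`, with values in `[0, ∞]`. -/
def hardyNormSq (f : ℂ → ℂ) : ℝ≥0∞ := ∑' n, ‖taylorCoeff f n‖ₑ ^ 2

/-- The Hardy space `H²` of the disk. -/
def hardySpace : Set (ℂ → ℂ) := {f | IsHol f ∧ hardyNormSq f < ∞}

/-- The inner product `⟨f, g⟩_{H²} = ∑ aₙ(f) conj (aₙ(g))`; the series converges absolutely for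
`f, g ∈ H²`. -/
def hardyInner (f g : ℂ → ℂ) : ℂ := ∑' n, taylorCoeff f n * conj (taylorCoeff g n)

/-- The model space `K_u = H² ⊖ u H²`. -/
def modelSpace (u : ℂ → ℂ) : Set (ℂ → ℂ) :=
  {f | f ∈ hardySpace ∧ ∀ h ∈ hardySpace, hardyInner f (fun z => u z * h z) = 0}

/-! ### The local Dirichlet space -/

/-- The local Dirichlet integral
`D_ζ(f) = (1/π) ∫_𝔻 |f'(z)|² (1 - |z|²) / |z - ζ|² dA(z)`, with values in `[0, ∞]`. -/
def dirichletIntegral (ζ : ℂ) (f : ℂ → ℂ) : ℝ≥0∞ :=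
  ENNReal.ofReal (1 / Real.pi) *
    ∫⁻ z in Metric.ball (0 : ℂ) 1,
      ENNReal.ofReal (‖deriv f z‖ ^ 2 * ((1 - ‖z‖ ^ 2) / ‖z - ζ‖ ^ 2))

/-- The local Dirichlet space `𝒟_ζ`. -/
def dirichletSpace (ζ : ℂ) : Set (ℂ → ℂ) := {f | IsHol f ∧ dirichletIntegral ζ f < ∞}

/-- The squared norm `‖f‖²_{H²} + D_ζ(f)` of `𝒟_ζ`. -/
def dirichletNormSq (ζ : ℂ) (f : ℂ → ℂ) : ℝ≥0∞ := hardyNormSq f + dirichletIntegral ζ f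

/-- Bounded inclusion into `𝒟_ζ` of a space `E` of functions on the disk, where `toFun` reads an
element of `E` as a function and `normSq` is the squared norm of `E`. -/
def EmbedsInDirichlet (ζ : ℂ) {E : Type*} (toFun : E → ℂ → ℂ) (normSq : E → ℝ≥0∞) : Prop :=
  (∀ f : E, toFun f ∈ dirichletSpace ζ) ∧
    ∃ C : ℝ≥0, ∀ f : E, dirichletNormSq ζ (toFun f) ≤ C * normSq f

/-- The embedding `K_u ↪ 𝒟_ζ`, where `K_u` carries the norm of `H²`. -/
def ModelSpaceEmbeds (u : ℂ → ℂ) (ζ : ℂ) : Prop :=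
  EmbedsInDirichlet ζ (fun f : modelSpace u => (f : ℂ → ℂ))
    (fun f : modelSpace u => hardyNormSq (f : ℂ → ℂ))

/-! ### The de Branges–Rovnyak space -/

/-- The kernel `k^b(z, ω) = (1 - conj (b ω) b z) / (1 - conj ω z)`. -/
def dbrKernel (b : ℂ → ℂ) (z w : ℂ) : ℂ := (1 - conj (b w) * b z) / (1 - conj w * z)

/-- The kernel `k^b` on the unit disk, as an operator-valued matrix. -/
def dbrMatrix (b : ℂ → ℂ) : Matrix Complex.UnitDisc Complex.UnitDisc (ℂ →L[ℂ] ℂ) :=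
  Matrix.of fun z w => dbrKernel b z w • (1 : ℂ →L[ℂ] ℂ)

/-- The Schur class: holomorphic functions `b` on the unit disk with `‖b‖_{H^∞} ≤ 1`. -/
structure SchurFunction where
  toFun : ℂ → ℂ
  isHol : IsHol toFun
  norm_le : hInftyNorm toFun ≤ 1

instance : CoeFun SchurFunction (fun _ => ℂ → ℂ) := ⟨SchurFunction.toFun⟩

lemma SchurFunction.norm_apply_le (b : SchurFunction) {z : ℂ} (hz : z ∈ Metric.ball (0 : ℂ) 1) :
    ‖b z‖ ≤ 1 := by
  have h : ‖b z‖ₑ ≤ 1 := (le_iSup₂_of_le (f := fun z _ => ‖b.toFun z‖ₑ) z hz le_rfl).trans b.norm_le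
  have h2 := ENNReal.toReal_mono ENNReal.one_ne_top h
  simpa using h2

lemma one_sub_conj_mul_ne_zero {w z : ℂ} (hw : ‖w‖ < 1) (hz : ‖z‖ ≤ 1) : 1 - conj w * z ≠ 0 := by
  intro h
  have h1 : ‖conj w * z‖ = 1 := by rw [← sub_eq_zero.mp h]; simp
  rw [norm_mul, RCLike.norm_conj] at h1
  nlinarith [norm_nonneg w, norm_nonneg z]

/-- A finite combination of Szegő kernels. -/
def szegoSum (s : Finset Complex.UnitDisc) (a : Complex.UnitDisc → ℂ) (z : ℂ) : ℂ :=
  ∑ x ∈ s, a x / (1 - conj (x : ℂ) * z)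

lemma differentiableAt_szegoSum (s : Finset Complex.UnitDisc) (a : Complex.UnitDisc → ℂ) {z : ℂ}
    (hz : ‖z‖ ≤ 1) : DifferentiableAt ℂ (szegoSum s a) z := by
  unfold szegoSum
  refine DifferentiableAt.fun_sum fun x _ => ?_
  exact (differentiableAt_const _).div (by fun_prop) (one_sub_conj_mul_ne_zero x.norm_lt_one hz)

lemma diffContOnCl_szegoSum (s : Finset Complex.UnitDisc) (a : Complex.UnitDisc → ℂ) :
    DiffContOnCl ℂ (szegoSum s a) (Metric.ball 0 1) := by
  refine DifferentiableOn.diffContOnCl fun z hz => ?_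
  rw [closure_ball _ one_ne_zero, mem_closedBall_zero_iff] at hz
  exact (differentiableAt_szegoSum s a hz).differentiableWithinAt

lemma conj_szegoSum (s : Finset Complex.UnitDisc) (a : Complex.UnitDisc → ℂ) {z : ℂ}
    (hz : ‖z‖ = 1) :
    conj (szegoSum s a z) = ∑ x ∈ s, conj (a x) * (z / (z - x)) := by
  unfold szegoSum
  rw [map_sum]
  refine Finset.sum_congr rfl fun x _ => ?_
  have hz0 : z ≠ 0 := by intro h; simp [h] at hz
  have hc : conj z = z⁻¹ := by rw [Complex.inv_eq_conj hz]
  have hzx : z - x ≠ 0 := by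
    intro h
    have := x.norm_lt_one
    rw [← sub_eq_zero.mp h] at this
    linarith
  simp only [map_div₀, map_sub, map_one, map_mul, Complex.conj_conj, hc]
  have h2 : 1 - (x : ℂ) * z⁻¹ = (z - x) / z := by field_simp
  rw [h2]
  field_simp

lemma circleIntegrable_mul_conj {h : ℂ → ℂ} (hh : DiffContOnCl ℂ h (Metric.ball 0 1))
    (s : Finset Complex.UnitDisc) (a : Complex.UnitDisc → ℂ) :
    CircleIntegrable (fun z => h z * conj (szegoSum s a z)) 0 1 := by
  refine ContinuousOn.circleIntegrable zero_le_one ?_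
  have h1 := hh.continuousOn
  have h2 := (diffContOnCl_szegoSum s a).continuousOn
  rw [closure_ball _ one_ne_zero] at h1 h2
  exact (h1.mono Metric.sphere_subset_closedBall).mul
    (Complex.continuous_conj.comp_continuousOn (h2.mono Metric.sphere_subset_closedBall))

lemma circleAverage_mul_conj {h : ℂ → ℂ} (hh : DiffContOnCl ℂ h (Metric.ball 0 1))
    (s : Finset Complex.UnitDisc) (a : Complex.UnitDisc → ℂ) :
    Real.circleAverage (fun z => h z * conj (szegoSum s a z)) 0 1
      = ∑ x ∈ s, conj (a x) * h x := by
  have h1 : Real.circleAverage (fun z => h z * conj (szegoSum s a z)) 0 1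
      = Real.circleAverage (fun z => ∑ x ∈ s, conj (a x) • (((z - 0) / (z - x)) • h z)) 0 1 := by
    refine Real.circleAverage_congr_sphere fun z hz => ?_
    have hz1 : ‖z‖ = 1 := by simpa using hz
    simp only [conj_szegoSum s a hz1, Finset.mul_sum, smul_eq_mul, sub_zero]
    exact Finset.sum_congr rfl fun x _ => by ring
  rw [h1, Real.circleAverage_fun_sum]
  · refine Finset.sum_congr rfl fun x _ => ?_
    rw [Real.circleAverage_fun_smul, DiffContOnCl.circleAverage_smul_div]
    · rfl
    · simpa using hh
    · simpa using x.norm_lt_one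
  · intro x _
    refine ContinuousOn.circleIntegrable zero_le_one ?_
    have h1 := hh.continuousOn
    rw [closure_ball _ one_ne_zero] at h1
    have h4 : ContinuousOn (fun z : ℂ => (z - 0) / (z - x)) (Metric.sphere 0 1) := ?_
    · exact (h4.smul (h1.mono Metric.sphere_subset_closedBall)).const_smul (conj (a x))
    refine ContinuousOn.div (by fun_prop) (by fun_prop) fun z hz => ?_
    intro h
    have h3 := x.norm_lt_one
    rw [← sub_eq_zero.mp h] at h3
    rw [mem_sphere_zero_iff_norm] at hz
    linarith

/-- Positivity of `k^b` for `b` continuous up to the boundary. -/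
lemma dbrKernel_nonneg_of_diffContOnCl {b : ℂ → ℂ} (hb : DiffContOnCl ℂ b (Metric.ball 0 1))
    (hb1 : ∀ z ∈ Metric.closedBall (0 : ℂ) 1, ‖b z‖ ≤ 1)
    (s : Finset Complex.UnitDisc) (c : Complex.UnitDisc → ℂ) :
    0 ≤ (∑ x ∈ s, ∑ y ∈ s, dbrKernel b y x * c x * conj (c y)).re := by
  set f := szegoSum s c with hf
  set g := szegoSum s (fun x => c x * conj (b x)) with hg
  have hfd : DiffContOnCl ℂ f (Metric.ball 0 1) := diffContOnCl_szegoSum _ _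
  have hgd : DiffContOnCl ℂ g (Metric.ball 0 1) := diffContOnCl_szegoSum _ _
  have hkd : DiffContOnCl ℂ (fun z => f z - 2 * (b z * g z)) (Metric.ball 0 1) :=
    hfd.sub ((hb.smul hgd).const_smul (2 : ℂ))
  have hi1 := circleIntegrable_mul_conj hkd s c
  have hi2 := circleIntegrable_mul_conj hgd s (fun x => c x * conj (b x))
  have key : (∑ x ∈ s, ∑ y ∈ s, dbrKernel b y x * c x * conj (c y))
      = Real.circleAverage (fun z => (f z - 2 * (b z * g z)) * conj (f z) + g z * conj (g z)) 0 1 := by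
    rw [Real.circleAverage_fun_add hi1 hi2, circleAverage_mul_conj hkd,
      circleAverage_mul_conj hgd, ← Finset.sum_add_distrib, Finset.sum_comm]
    refine Finset.sum_congr rfl fun y _ => ?_
    simp only [map_mul, Complex.conj_conj]
    have e : conj (c y) * (f y - 2 * (b y * g y)) + conj (c y) * b y * g y
        = conj (c y) * (f y - b y * g y) := by ring
    rw [e, hf, hg]
    unfold szegoSum
    rw [Finset.mul_sum, ← Finset.sum_sub_distrib, Finset.mul_sum]
    refine Finset.sum_congr rfl fun x _ => ?_
    unfold dbrKernel
    ring
  have hre := Complex.reCLM.circleAverage_comp_comm (hi1.add hi2)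
  have hpos : 0 ≤ Real.circleAverage (Complex.reCLM ∘
      (fun z => (f z - 2 * (b z * g z)) * conj (f z) + g z * conj (g z))) 0 1 := by
    refine Real.circleAverage_nonneg_of_nonneg fun z hz => ?_
    have hz1 : z ∈ Metric.closedBall (0 : ℂ) 1 := by
      rw [abs_one] at hz
      exact Metric.sphere_subset_closedBall hz
    have hbz := hb1 z hz1
    have h1 : (f z - 2 * (b z * g z)) * conj (f z) + g z * conj (g z)
        = ((‖f z‖ ^ 2 + ‖g z‖ ^ 2 : ℝ) : ℂ) - 2 * (b z * g z * conj (f z)) := by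
      push_cast
      rw [← Complex.mul_conj', ← Complex.mul_conj']
      ring
    have h2 : (b z * g z * conj (f z)).re ≤ ‖g z‖ * ‖f z‖ := by
      refine (Complex.re_le_norm _).trans ?_
      rw [norm_mul, norm_mul, RCLike.norm_conj]
      have := mul_nonneg (norm_nonneg (g z)) (norm_nonneg (f z))
      nlinarith
    simp only [Function.comp_apply, Complex.reCLM_apply, h1]
    rw [Complex.sub_re, Complex.ofReal_re]
    have h3 : (2 * (b z * g z * conj (f z))).re = 2 * (b z * g z * conj (f z)).re := by simp
    rw [h3]
    nlinarith [sq_nonneg (‖f z‖ - ‖g z‖)]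
  rw [key]
  exact hpos.trans_eq hre

lemma dbrKernel_nonneg (b : SchurFunction) (s : Finset Complex.UnitDisc)
    (c : Complex.UnitDisc → ℂ) :
    0 ≤ (∑ x ∈ s, ∑ y ∈ s, dbrKernel b y x * c x * conj (c y)).re := by
  have hb : ∀ x : Complex.UnitDisc, Filter.Tendsto (fun r : ℝ => b (r * x)) (𝓝[<] 1) (𝓝 (b x)) := by
    intro x
    have hx : (x : ℂ) ∈ Metric.ball (0 : ℂ) 1 := by simpa using x.norm_lt_one
    have h1 : ContinuousAt b (x : ℂ) :=
      (b.isHol.differentiableAt (Metric.isOpen_ball.mem_nhds hx)).continuousAt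
    have h2 : Filter.Tendsto (fun r : ℝ => (r : ℂ) * x) (𝓝[<] 1) (𝓝 (x : ℂ)) := by
      have : Continuous (fun r : ℝ => (r : ℂ) * x) := by fun_prop
      have h3 := (this.tendsto 1).mono_left (nhdsWithin_le_nhds (s := Set.Iio (1 : ℝ)))
      simpa using h3
    exact h1.tendsto.comp h2
  have hlim : Filter.Tendsto (fun r : ℝ =>
      (∑ x ∈ s, ∑ y ∈ s, dbrKernel (fun z => b (r * z)) y x * c x * conj (c y)).re) (𝓝[<] 1)
      (𝓝 (∑ x ∈ s, ∑ y ∈ s, dbrKernel b y x * c x * conj (c y)).re) := by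
    refine (Complex.continuous_re.tendsto _).comp ?_
    refine tendsto_finsetSum _ fun x _ => tendsto_finsetSum _ fun y _ => ?_
    unfold dbrKernel
    refine Filter.Tendsto.mul_const _ (Filter.Tendsto.mul_const _ (Filter.Tendsto.div_const ?_ _))
    exact tendsto_const_nhds.sub
      (((Complex.continuous_conj.tendsto _).comp (hb x)).mul (hb y))
  refine ge_of_tendsto hlim ?_
  filter_upwards [Ioo_mem_nhdsLT (zero_lt_one (α := ℝ))] with r hr
  have hmem : ∀ z ∈ Metric.closedBall (0 : ℂ) 1, (r : ℂ) * z ∈ Metric.ball (0 : ℂ) 1 := by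
    intro z hz
    rw [mem_closedBall_zero_iff] at hz
    rw [mem_ball_zero_iff, norm_mul, Complex.norm_real, Real.norm_of_nonneg hr.1.le]
    nlinarith [hr.1, hr.2, norm_nonneg z]
  refine dbrKernel_nonneg_of_diffContOnCl ?_ (fun z hz => b.norm_apply_le (hmem z hz)) s c
  refine DifferentiableOn.diffContOnCl ?_
  rw [closure_ball _ one_ne_zero]
  exact b.isHol.comp (by fun_prop) hmem

theorem posSemidef_dbrMatrix (b : SchurFunction) : (dbrMatrix b).PosSemidef := by
  have htfae := RKHS.posSemidef_tfae (K := dbrMatrix b)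
  refine (htfae.out 0 2).mpr ?_
  refine ⟨?_, fun v => ?_⟩
  · ext x y
    simp [dbrMatrix, dbrKernel, Matrix.conjTranspose_apply, mul_comm]
  · have h := dbrKernel_nonneg b v.support v
    rw [← Complex.conj_re] at h
    convert h using 1
    simp only [Finsupp.sum, map_sum, dbrMatrix, Matrix.of_apply, RCLike.re_to_complex, Complex.re_sum]
    refine Finset.sum_congr rfl fun x _ => Finset.sum_congr rfl fun y _ => ?_
    simp [mul_comm]

instance (b : SchurFunction) : Fact (dbrMatrix b).PosSemidef := ⟨posSemidef_dbrMatrix b⟩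

/-- The de Branges–Rovnyak space `H(b)`: the reproducing kernel Hilbert space with kernel `k^b`. -/
abbrev DeBrangesRovnyak (b : SchurFunction) : Type := RKHS.OfKernel (dbrMatrix b)

/-- A function on the unit disk, extended by zero to `ℂ`. -/
def extendDisc (f : Complex.UnitDisc → ℂ) (z : ℂ) : ℂ :=
  if h : ‖z‖ < 1 then f (Complex.UnitDisc.mk z h) else 0

/-- The embedding `H(b) ↪ 𝒟_ζ`. -/
def DeBrangesRovnyakEmbeds (b : SchurFunction) (ζ : ℂ) : Prop :=
  EmbedsInDirichlet ζ (fun f : DeBrangesRovnyak b => extendDisc f)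
    (fun f : DeBrangesRovnyak b => ‖f‖ₑ ^ 2)

end LocalDirichlet

end

/-!
Necessity of `ζ ∉ σ(b)`: test the embedding on the kernels `k_w = k^b(·, w)`. The mean value
inequality for `k_w'` on the disk of radius `(1 - |w|) / 2` about `w`, with the Schwarz–Pick
inequality bounding `|b'(w)|`, bounds `D_ζ(k_w)` from below; compared with
`‖k_w‖² = (1 - |b(w)|²) / (1 - |w|²)`, this forces `|b(w)| → 1` as `w → ζ`.

Sufficiency: if `|b|` has boundary values of modulus `1` near `ζ`, a barrier and Harnack's
inequality for `-log |b|` give `1 - |b(z)| = O(1 - |z|)` as `z → ζ`. Julia's inequality then yields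
a unimodular `β` with `Re (1 - β b(z)) ≤ C (|z - ζ|² + 1 - |z|)`, so that the quadratic form of
`k^b` at `∑ c_x δ_x` is at most `2 C ‖(z - ζ) ∑ c_x k_x‖²` in `H²`, where `k_x` is the Szegő kernel.
By duality each `f ∈ H(b)` is `a + (z - ζ) g` with `g ∈ H²` and `‖g‖² ≤ 2 C ‖f‖²`, and
`D_ζ(a + (z - ζ) g) = ‖g‖²`.
-/

noncomputable section

namespace LocalDirichlet

open Filter MeasureTheory Metric Set

open scoped Real

/-! ### Power series on the unit disk and the Hardy norm -/

lemma ofReal_mul_mem_ball {s : ℝ} (hs0 : 0 ≤ s) (hs1 : s < 1) {z : ℂ} (hz : ‖z‖ ≤ 1) :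
    (s : ℂ) * z ∈ ball (0 : ℂ) 1 := by
  rw [mem_ball_zero_iff, norm_mul, Complex.norm_real, Real.norm_of_nonneg hs0]
  exact (mul_le_of_le_one_right hs0 hz).trans_lt hs1

lemma hasSum_taylorCoeff {f : ℂ → ℂ} (hf : IsHol f) {z : ℂ} (hz : z ∈ ball (0 : ℂ) 1) :
    HasSum (fun n => taylorCoeff f n * z ^ n) (f z) := by
  refine (Complex.hasSum_taylorSeries_on_ball hf hz).congr_fun fun n => ?_
  simp only [taylorCoeff, sub_zero, smul_eq_mul]
  ring

lemma hasFPowerSeriesOnBall_of_hasSum {f : ℂ → ℂ} {a : ℕ → ℂ}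
    (h : ∀ z ∈ ball (0 : ℂ) 1, HasSum (fun n => a n * z ^ n) (f z)) :
    HasFPowerSeriesOnBall f (FormalMultilinearSeries.ofScalars ℂ a) 0 1 where
  r_le := by
    refine ENNReal.le_of_forall_nnreal_lt fun r hr => ?_
    have hr1 : (r : ℝ) < 1 := by exact_mod_cast hr
    refine FormalMultilinearSeries.le_radius_of_tendsto _ (l := 0) ?_
    simpa [FormalMultilinearSeries.ofScalars_norm] using
      (h (r : ℂ) (by simpa using hr1)).summable.tendsto_atTop_zero.norm
  r_pos := one_pos
  hasSum := fun {y} hy => by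
    have hy1 : y ∈ ball (0 : ℂ) 1 := by
      rwa [mem_ball_zero_iff, ← ENNReal.ofReal_lt_one, ofReal_norm, ← mem_eball_zero_iff]
    simpa [FormalMultilinearSeries.ofScalars_apply_eq, mul_comm] using h y hy1

lemma isHol_of_hasSum {f : ℂ → ℂ} {a : ℕ → ℂ}
    (h : ∀ z ∈ ball (0 : ℂ) 1, HasSum (fun n => a n * z ^ n) (f z)) : IsHol f := by
  refine (hasFPowerSeriesOnBall_of_hasSum h).differentiableOn.mono fun z hz => ?_
  rwa [mem_eball_zero_iff, ← ofReal_norm, ENNReal.ofReal_lt_one, ← mem_ball_zero_iff]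

lemma taylorCoeff_of_hasSum {f : ℂ → ℂ} {a : ℕ → ℂ}
    (h : ∀ z ∈ ball (0 : ℂ) 1, HasSum (fun n => a n * z ^ n) (f z)) (n : ℕ) :
    taylorCoeff f n = a n := by
  have hseries := (hasFPowerSeriesOnBall_of_hasSum fun z hz =>
    hasSum_taylorCoeff (isHol_of_hasSum h) hz).hasFPowerSeriesAt.eq_formalMultilinearSeries
      (hasFPowerSeriesOnBall_of_hasSum h).hasFPowerSeriesAt
  simpa using congrArg (fun p => FormalMultilinearSeries.coeff p n) hseries

lemma taylorCoeff_deriv (f : ℂ → ℂ) (n : ℕ) :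
    taylorCoeff (deriv f) n = (n + 1) * taylorCoeff f (n + 1) := by
  have h1 : (n.factorial : ℂ) ≠ 0 := by exact_mod_cast n.factorial_ne_zero
  have h2 : (n + 1 : ℂ) ≠ 0 := by exact_mod_cast n.succ_ne_zero
  rw [taylorCoeff, taylorCoeff, iteratedDeriv_succ', Nat.factorial_succ]
  push_cast
  field_simp

lemma IsHol.deriv {f : ℂ → ℂ} (hf : IsHol f) : IsHol (deriv f) :=
  DifferentiableOn.deriv hf isOpen_ball

lemma IsHol.continuousOn_sphere {f : ℂ → ℂ} (hf : IsHol f) {r : ℝ} (hr : r < 1) :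
    ContinuousOn f (sphere 0 r) :=
  hf.continuousOn.mono (sphere_subset_ball hr)

lemma sum_norm_sq_eq_circleAverage (a : ℕ → ℂ) (N : ℕ) :
    ∑ n ∈ Finset.range N, ‖a n‖ ^ 2
      = Real.circleAverage (fun z => ‖∑ n ∈ Finset.range N, a n * z ^ n‖ ^ 2) 0 1 := by
  set p : Polynomial ℂ := ∑ n ∈ Finset.range N, Polynomial.monomial n (a n) with hp
  have hcoeff (n : ℕ) : p.coeff n = if n < N then a n else 0 := by
    simp [hp, Polynomial.finsetSum_coeff, Polynomial.coeff_monomial]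
  have heval (z : ℂ) : p.eval z = ∑ n ∈ Finset.range N, a n * z ^ n := by
    simp [hp, Polynomial.eval_finsetSum]
  simp only [← heval, ← p.sum_sq_norm_coeff_eq_circleAverage]
  have hsub : p.support ⊆ Finset.range N := fun n hn => by
    rw [Polynomial.mem_support_iff, hcoeff] at hn
    exact Finset.mem_range.mpr (by_contra fun h => hn (if_neg h))
  rw [Finset.sum_subset hsub fun n _ hn => by simp [Polynomial.notMem_support_iff.mp hn]]
  exact Finset.sum_congr rfl fun n hn => by rw [hcoeff, if_pos (Finset.mem_range.mp hn)]

lemma hasSum_norm_sq_circleAverage {a : ℕ → ℂ} {G : ℂ → ℂ} (ha : Summable fun n => ‖a n‖)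
    (hG : ∀ z ∈ sphere (0 : ℂ) 1, HasSum (fun n => a n * z ^ n) (G z)) :
    HasSum (fun n => ‖a n‖ ^ 2) (Real.circleAverage (fun z => ‖G z‖ ^ 2) 0 1) := by
  rw [hasSum_iff_tendsto_nat_of_nonneg fun _ => sq_nonneg _]
  simp only [sum_norm_sq_eq_circleAverage, Real.circleAverage_def]
  refine Tendsto.const_smul ?_ _
  refine intervalIntegral.tendsto_integral_filter_of_dominated_convergence
    (fun _ => (∑' n, ‖a n‖) ^ 2) (.of_forall fun N => ?_) (.of_forall fun N => ?_) ?_ ?_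
  · exact Continuous.aestronglyMeasurable (by fun_prop)
  · refine .of_forall fun θ _ => ?_
    rw [Real.norm_of_nonneg (sq_nonneg _)]
    gcongr
    refine (norm_sum_le _ _).trans ?_
    simpa using ha.sum_le_tsum (Finset.range N) fun _ _ => norm_nonneg _
  · simp
  · exact .of_forall fun θ _ =>
      ((hG _ (circleMap_mem_sphere 0 zero_le_one θ)).tendsto_sum_nat.norm).pow 2

lemma hasSum_circleAverage_of_isHol {f : ℂ → ℂ} (hf : IsHol f) {r : ℝ} (hr0 : 0 ≤ r) (hr : r < 1) :
    HasSum (fun n => ‖taylorCoeff f n‖ ^ 2 * r ^ (2 * n))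
      (Real.circleAverage (fun z => ‖f z‖ ^ 2) 0 r) := by
  have hdilate (z : ℂ) (hz : ‖z‖ = 1) :
      HasSum (fun n => taylorCoeff f n * (r : ℂ) ^ n * z ^ n) (f (r * z)) :=
    (hasSum_taylorCoeff hf (ofReal_mul_mem_ball hr0 hr hz.le)).congr_fun fun n => by ring
  have hsum : Summable fun n => ‖taylorCoeff f n * (r : ℂ) ^ n‖ := by
    simpa using (hdilate 1 norm_one).summable.norm
  rw [Real.circleAverage_eq_circleAverage_zero_one]
  simp only [add_zero]
  refine (hasSum_norm_sq_circleAverage hsum fun z hz =>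
    hdilate z (mem_sphere_zero_iff_norm.mp hz)).congr_fun fun n => ?_
  rw [norm_mul, norm_pow, Complex.norm_real, Real.norm_of_nonneg hr0, mul_pow, pow_mul' r 2 n]

lemma enorm_sq_eq_ofReal {E : Type*} [SeminormedAddCommGroup E] (x : E) :
    ‖x‖ₑ ^ 2 = ENNReal.ofReal (‖x‖ ^ 2) := by
  rw [ENNReal.ofReal_pow (norm_nonneg _), ofReal_norm]

lemma hardyNormSq_le_of_circleAverage_le {f : ℂ → ℂ} (hf : IsHol f) {M : ℝ}
    (h : ∀ r ∈ Ioo (0 : ℝ) 1, Real.circleAverage (fun z => ‖f z‖ ^ 2) 0 r ≤ M) :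
    hardyNormSq f ≤ ENNReal.ofReal M := by
  refine ENNReal.tsum_le_of_sum_range_le fun N => ?_
  simp only [enorm_sq_eq_ofReal]
  rw [← ENNReal.ofReal_sum_of_nonneg fun _ _ => sq_nonneg _]
  refine ENNReal.ofReal_le_ofReal ?_
  have hlim : Tendsto (fun r : ℝ => ∑ n ∈ Finset.range N, ‖taylorCoeff f n‖ ^ 2 * r ^ (2 * n))
      (𝓝[<] 1) (𝓝 (∑ n ∈ Finset.range N, ‖taylorCoeff f n‖ ^ 2)) := by
    have hcont : Continuous fun r : ℝ =>
      ∑ n ∈ Finset.range N, ‖taylorCoeff f n‖ ^ 2 * r ^ (2 * n) := by fun_prop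
    simpa using (hcont.tendsto 1).mono_left nhdsWithin_le_nhds
  refine le_of_tendsto hlim ?_
  filter_upwards [Ioo_mem_nhdsLT (zero_lt_one (α := ℝ))] with r hr
  exact (sum_le_hasSum _ (fun n _ => mul_nonneg (sq_nonneg _) (pow_nonneg hr.1.le _))
    (hasSum_circleAverage_of_isHol hf hr.1.le hr.2)).trans (h r hr)

lemma summable_norm_sq_taylorCoeff {f : ℂ → ℂ} (hf : hardyNormSq f < ∞) :
    Summable fun n => ‖taylorCoeff f n‖ ^ 2 := by
  simpa using ENNReal.summable_toReal hf.ne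

lemma hardyNormSq_eq_ofReal {f : ℂ → ℂ} (hf : hardyNormSq f < ∞) :
    hardyNormSq f = ENNReal.ofReal (∑' n, ‖taylorCoeff f n‖ ^ 2) := by
  rw [ENNReal.ofReal_tsum_of_nonneg (fun _ => sq_nonneg _) (summable_norm_sq_taylorCoeff hf)]
  exact tsum_congr fun n => enorm_sq_eq_ofReal _

lemma circleAverage_le_tsum {f : ℂ → ℂ} (hf : f ∈ hardySpace) {r : ℝ} (hr0 : 0 ≤ r) (hr : r < 1) :
    Real.circleAverage (fun z => ‖f z‖ ^ 2) 0 r ≤ ∑' n, ‖taylorCoeff f n‖ ^ 2 :=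
  hasSum_le (fun _ => mul_le_of_le_one_right (sq_nonneg _) (pow_le_one₀ hr0 hr.le))
    (hasSum_circleAverage_of_isHol hf.1 hr0 hr) (summable_norm_sq_taylorCoeff hf.2).hasSum

/-! ### Area integrals in polar coordinates -/

lemma norm_circleAverage_le {E : Type*} [NormedAddCommGroup E] [NormedSpace ℝ E] (f : ℂ → E)
    (c : ℂ) (R : ℝ) :
    ‖Real.circleAverage f c R‖ ≤ Real.circleAverage (fun z => ‖f z‖) c R := by
  rw [Real.circleAverage_def, Real.circleAverage_def, norm_smul,
    Real.norm_of_nonneg (by positivity), smul_eq_mul]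
  gcongr
  exact intervalIntegral.norm_integral_le_integral_norm (by positivity)

lemma lintegral_Ioo_circleMap {ψ : ℂ → ℝ} {c : ℂ} {r : ℝ} (hψ : ContinuousOn ψ (sphere c |r|))
    (h0 : ∀ z, 0 ≤ ψ z) :
    ∫⁻ θ in Ioo (-π) π, ENNReal.ofReal (ψ (circleMap c r θ))
      = ENNReal.ofReal (2 * π * Real.circleAverage ψ c r) := by
  have hc : Continuous fun θ => ψ (circleMap c r θ) :=
    hψ.comp_continuous (by fun_prop) fun θ => by simp
  rw [← ofReal_integral_eq_lintegral_ofReal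
    ((hc.integrableOn_Icc (a := -π) (b := π)).mono_set Ioo_subset_Icc_self)
    (.of_forall fun θ => h0 _)]
  congr 1
  rw [Real.circleAverage_eq_integral_add (-π), smul_eq_mul,
    mul_inv_cancel_left₀ (by positivity), intervalIntegral.integral_comp_add_right
      (fun θ => ψ (circleMap c r θ)), ← integral_Ioc_eq_integral_Ioo,
    ← intervalIntegral.integral_of_le (by linarith [Real.pi_pos])]
  congr 1 <;> ring

lemma lintegral_eq_lintegral_circleMap {Ψ : ℂ → ℝ≥0∞} (hΨ : Measurable Ψ) (c : ℂ) :
    ∫⁻ z, Ψ z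
      = ∫⁻ r in Ioi 0, ENNReal.ofReal r * ∫⁻ θ in Ioo (-π) π, Ψ (circleMap c r θ) := by
  have hpolar (p : ℝ × ℝ) : c + Complex.polarCoord.symm p = circleMap c p.1 p.2 := by
    rw [Complex.polarCoord_symm_apply]
    simp [circleMap, Complex.exp_mul_I]
  have hmeas : Measurable fun p : ℝ × ℝ => circleMap c p.1 p.2 :=
    Continuous.measurable (by unfold circleMap; fun_prop)
  rw [← lintegral_add_left_eq_self _ c, ← Complex.lintegral_comp_polarCoord_symm,
    polarCoord_target, Measure.volume_eq_prod, ← Measure.prod_restrict]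
  simp only [hpolar, smul_eq_mul]
  rw [lintegral_prod _ (by fun_prop)]
  exact lintegral_congr fun r => lintegral_const_mul' _ _ ENNReal.ofReal_ne_top

lemma lintegral_ball_eq_lintegral_circleAverage {ψ : ℂ → ℝ} {c : ℂ} {R : ℝ}
    (hψ : ContinuousOn ψ (ball c R)) (h0 : ∀ z, 0 ≤ ψ z) :
    ∫⁻ z in ball c R, ENNReal.ofReal (ψ z)
      = ∫⁻ r in Ioo 0 R, ENNReal.ofReal (r * (2 * π * Real.circleAverage ψ c r)) := by
  classical
  have hmeas : Measurable ((ball c R).indicator fun z => ENNReal.ofReal (ψ z)) := by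
    rw [← piecewise_eq_indicator]
    exact (ENNReal.continuous_ofReal.comp_continuousOn hψ).measurable_piecewise
      continuousOn_const isOpen_ball.measurableSet
  have hcircle : ∀ r ∈ Ioi (0 : ℝ), ENNReal.ofReal r * ∫⁻ θ in Ioo (-π) π,
      (ball c R).indicator (fun z => ENNReal.ofReal (ψ z)) (circleMap c r θ)
      = (Iio R).indicator
        (fun r => ENNReal.ofReal (r * (2 * π * Real.circleAverage ψ c r))) r := by
    intro r (hr : 0 < r)
    have hmem (θ : ℝ) : circleMap c r θ ∈ ball c R ↔ r < R := by
      simp [circleMap, abs_of_pos hr]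
    by_cases hrR : r < R
    · have hsphere : ContinuousOn ψ (sphere c |r|) :=
        hψ.mono (sphere_subset_ball (by rwa [abs_of_pos hr]))
      simp only [indicator, hmem, hrR, if_true, mem_Iio]
      rw [lintegral_Ioo_circleMap hsphere h0, ENNReal.ofReal_mul hr.le]
    · simp [indicator, hmem, hrR]
  rw [← lintegral_indicator isOpen_ball.measurableSet, lintegral_eq_lintegral_circleMap hmeas c,
    setLIntegral_congr_fun measurableSet_Ioi hcircle, setLIntegral_indicator measurableSet_Iio,
    Iio_inter_Ioi]

lemma norm_sq_le_circleAverage {h : ℂ → ℂ} {c : ℂ} {r R : ℝ} (hr : 0 ≤ r) (hrR : r < R)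
    (hh : DifferentiableOn ℂ h (ball c R)) :
    ‖h c‖ ^ 2 ≤ Real.circleAverage (fun z => ‖h z‖ ^ 2) c r := by
  have hd : DiffContOnCl ℂ (fun z => h z ^ 2) (ball c |r|) := by
    rw [abs_of_nonneg hr]
    refine DifferentiableOn.diffContOnCl ((hh.pow 2).mono ?_)
    exact closure_ball_subset_closedBall.trans (closedBall_subset_ball hrR)
  have hmean := norm_circleAverage_le (fun z => h z ^ 2) c r
  simpa only [hd.circleAverage, norm_pow] using hmean

lemma lintegral_Ioo_ofReal {a b : ℝ} (hab : a ≤ b) {g : ℝ → ℝ} (hg : Continuous g)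
    (h0 : ∀ x ∈ Ioo a b, 0 ≤ g x) :
    ∫⁻ x in Ioo a b, ENNReal.ofReal (g x) = ENNReal.ofReal (∫ x in a..b, g x) := by
  rw [intervalIntegral.integral_of_le hab, integral_Ioc_eq_integral_Ioo,
    ofReal_integral_eq_lintegral_ofReal]
  · exact (hg.integrableOn_Icc (a := a) (b := b)).mono_set Ioo_subset_Icc_self
  · exact (ae_restrict_iff' measurableSet_Ioo).mpr (.of_forall h0)

lemma norm_sq_mul_area_le {h : ℂ → ℂ} {c : ℂ} {R : ℝ} (hR : 0 ≤ R)
    (hh : DifferentiableOn ℂ h (ball c R)) :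
    ENNReal.ofReal (π * R ^ 2 * ‖h c‖ ^ 2) ≤ ∫⁻ z in ball c R, ENNReal.ofReal (‖h z‖ ^ 2) := by
  have hradial : ENNReal.ofReal (π * R ^ 2 * ‖h c‖ ^ 2)
      = ∫⁻ r in Ioo 0 R, ENNReal.ofReal (r * (2 * π * ‖h c‖ ^ 2)) := by
    rw [lintegral_Ioo_ofReal hR (by fun_prop) (fun x hx => mul_nonneg hx.1.le (by positivity)),
      intervalIntegral.integral_mul_const, integral_id]
    congr 1
    ring
  have hc : ContinuousOn (fun z => ‖h z‖ ^ 2) (ball c R) := hh.continuousOn.norm.pow 2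
  rw [hradial, lintegral_ball_eq_lintegral_circleAverage hc fun z => sq_nonneg _]
  refine setLIntegral_mono' measurableSet_Ioo fun r hr => ENNReal.ofReal_le_ofReal ?_
  have := norm_sq_le_circleAverage hr.1.le hr.2 hh
  have := hr.1
  gcongr

lemma ofReal_circleAverage_norm_sq_mul_one_sub_norm_sq {H : ℂ → ℂ} (hH : IsHol H) {r : ℝ}
    (hr : r ∈ Ioo (0 : ℝ) 1) :
    ENNReal.ofReal (r * (2 * π * Real.circleAverage (fun z => ‖H z‖ ^ 2 * |1 - ‖z‖ ^ 2|) 0 r))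
      = ∑' k : ℕ, ENNReal.ofReal
        ((2 * π * ‖taylorCoeff H k‖ ^ 2) * (r ^ (2 * k + 1) - r ^ (2 * k + 3))) := by
  have hr2 : 0 ≤ 1 - r ^ 2 := by nlinarith [hr.1, hr.2]
  have hfactor : Real.circleAverage (fun z => ‖H z‖ ^ 2 * |1 - ‖z‖ ^ 2|) 0 r
      = (1 - r ^ 2) * Real.circleAverage (fun z => ‖H z‖ ^ 2) 0 r := by
    rw [← smul_eq_mul, ← Real.circleAverage_fun_smul]
    refine Real.circleAverage_congr_sphere fun z hz => ?_
    have hz1 : ‖z‖ = r := by simpa [abs_of_pos hr.1] using hz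
    simp only [hz1, smul_eq_mul, abs_of_nonneg hr2, mul_comm]
  have hsum : HasSum (fun k : ℕ =>
      (2 * π * ‖taylorCoeff H k‖ ^ 2) * (r ^ (2 * k + 1) - r ^ (2 * k + 3)))
      (r * (2 * π * Real.circleAverage (fun z => ‖H z‖ ^ 2 * |1 - ‖z‖ ^ 2|) 0 r)) := by
    rw [hfactor, show ∀ A : ℝ, r * (2 * π * ((1 - r ^ 2) * A)) = r * (2 * π * (1 - r ^ 2)) * A
      from fun A => by ring]
    exact ((hasSum_circleAverage_of_isHol hH hr.1.le hr.2).mul_left _).congr_fun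
      fun k => by ring
  rw [← hsum.tsum_eq, ENNReal.ofReal_tsum_of_nonneg (fun k => ?_) hsum.summable]
  have : r ^ (2 * k + 3) ≤ r ^ (2 * k + 1) := pow_le_pow_of_le_one hr.1.le hr.2.le (by omega)
  have := sub_nonneg.mpr this
  positivity

lemma lintegral_pow_sub_pow {C : ℝ} (hC : 0 ≤ C) (k : ℕ) :
    ∫⁻ r in Ioo (0 : ℝ) 1, ENNReal.ofReal (2 * π * C * (r ^ (2 * k + 1) - r ^ (2 * k + 3)))
      = ENNReal.ofReal π * ENNReal.ofReal (C / ((k + 1) * (k + 2))) := by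
  rw [lintegral_Ioo_ofReal zero_le_one (by fun_prop) fun r hr => ?_,
    ← ENNReal.ofReal_mul Real.pi_pos.le, intervalIntegral.integral_const_mul,
    intervalIntegral.integral_sub ((continuous_pow _).intervalIntegrable _ _)
      ((continuous_pow _).intervalIntegrable _ _), integral_pow, integral_pow]
  · congr 1
    have h1 : 2 * (k : ℝ) + 1 + 1 ≠ 0 := by positivity
    have h2 : 2 * (k : ℝ) + 3 + 1 ≠ 0 := by positivity
    push_cast
    simp only [one_pow, ne_eq, Nat.add_eq_zero_iff, not_false_eq_true, zero_pow, sub_zero,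
      one_ne_zero, and_false]
    field_simp
    ring
  · have : r ^ (2 * k + 3) ≤ r ^ (2 * k + 1) := pow_le_pow_of_le_one hr.1.le hr.2.le (by omega)
    have := sub_nonneg.mpr this
    positivity

lemma lintegral_norm_sq_mul_one_sub_norm_sq {H : ℂ → ℂ} (hH : IsHol H) :
    ∫⁻ z in ball (0 : ℂ) 1, ENNReal.ofReal (‖H z‖ ^ 2 * (1 - ‖z‖ ^ 2))
      = ENNReal.ofReal π *
        ∑' k : ℕ, ENNReal.ofReal (‖taylorCoeff H k‖ ^ 2 / ((k + 1) * (k + 2))) := by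
  have habs : ∫⁻ z in ball (0 : ℂ) 1, ENNReal.ofReal (‖H z‖ ^ 2 * (1 - ‖z‖ ^ 2))
      = ∫⁻ z in ball (0 : ℂ) 1, ENNReal.ofReal (‖H z‖ ^ 2 * |1 - ‖z‖ ^ 2|) := by
    refine setLIntegral_congr_fun isOpen_ball.measurableSet fun z hz => ?_
    rw [mem_ball_zero_iff] at hz
    rw [abs_of_nonneg (by nlinarith [norm_nonneg z])]
  have hc : ContinuousOn (fun z => ‖H z‖ ^ 2 * |1 - ‖z‖ ^ 2|) (ball 0 1) :=
    (hH.continuousOn.norm.pow 2).mul (by fun_prop)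
  rw [habs, lintegral_ball_eq_lintegral_circleAverage hc (fun z => by positivity),
    setLIntegral_congr_fun measurableSet_Ioo fun r hr =>
      ofReal_circleAverage_norm_sq_mul_one_sub_norm_sq hH hr,
    lintegral_tsum fun k => Measurable.aemeasurable (by fun_prop),
    ← ENNReal.tsum_mul_left]
  exact tsum_congr fun k => lintegral_pow_sub_pow (sq_nonneg _) k

/-! ### The local Dirichlet integral of `a + (z - ζ) g` -/

lemma norm_one_sub_conj_mul {ζ : ℂ} (hζ : ‖ζ‖ = 1) (z : ℂ) : ‖1 - conj ζ * z‖ = ‖z - ζ‖ := by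
  have hconj : conj ζ * ζ = 1 := by rw [Complex.conj_mul', hζ]; simp
  rw [← hconj, ← mul_sub, norm_mul, RCLike.norm_conj, hζ, one_mul, norm_sub_rev]

lemma one_sub_conj_mul_ne_zero' {ζ z : ℂ} (hζ : ‖ζ‖ = 1) (hz : ‖z‖ < 1) : 1 - conj ζ * z ≠ 0 := by
  rw [← norm_ne_zero_iff, norm_one_sub_conj_mul hζ, norm_ne_zero_iff, sub_ne_zero]
  rintro rfl
  exact hz.ne hζ

lemma taylorCoeff_succ_of_eq_one_sub_mul {F H : ℂ → ℂ} (hH : IsHol H) {c : ℂ}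
    (hF : ∀ z ∈ ball (0 : ℂ) 1, F z = (1 - c * z) * H z) (k : ℕ) :
    taylorCoeff F (k + 1) = taylorCoeff H (k + 1) - c * taylorCoeff H k := by
  refine taylorCoeff_of_hasSum
    (a := fun n => taylorCoeff H n - c * (if n = 0 then 0 else taylorCoeff H (n - 1)))
    (fun z hz => ?_) (k + 1)
  have hH_sum := hasSum_taylorCoeff hH hz
  have hshift : HasSum (fun n => c * (if n = 0 then 0 else taylorCoeff H (n - 1)) * z ^ n)
      (c * z * H z) := by
    rw [← hasSum_nat_add_iff' 1]
    simp only [Finset.range_one, Finset.sum_singleton, if_true, mul_zero, zero_mul, sub_zero]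
    refine (hH_sum.mul_left (c * z)).congr_fun fun n => ?_
    simp only [Nat.add_eq_zero_iff, one_ne_zero, and_false, if_false, Nat.add_sub_cancel]
    ring
  rw [hF z hz, sub_mul, one_mul]
  exact (hH_sum.sub hshift).congr_fun fun n => by ring

lemma norm_sub_ofReal_mul_sq_div (S g : ℂ) {n : ℝ} (hn : 0 < n) :
    ‖S - n * g‖ ^ 2 / (n * (n + 1)) = ‖g‖ ^ 2 + ‖S‖ ^ 2 / n - ‖S + g‖ ^ 2 / (n + 1) := by
  have hsub : ‖S - n * g‖ ^ 2 = ‖S‖ ^ 2 - 2 * n * (S * conj g).re + n ^ 2 * ‖g‖ ^ 2 := by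
    simp only [← Complex.normSq_eq_norm_sq, Complex.normSq_sub, map_mul, Complex.normSq_ofReal,
      Complex.conj_ofReal, mul_left_comm S, Complex.re_ofReal_mul]
    ring
  have hadd : ‖S + g‖ ^ 2 = ‖S‖ ^ 2 + 2 * (S * conj g).re + ‖g‖ ^ 2 := by
    simp only [← Complex.normSq_eq_norm_sq, Complex.normSq_add]
    ring
  rw [hsub, hadd]
  field_simp
  ring

section Recursion

variable {ζ : ℂ} {g h : ℕ → ℂ}

lemma pow_mul_eq_sum_sub_of_recursion (hζ : ‖ζ‖ = 1) (h0 : h 0 = g 0 - ζ * g 1)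
    (hsucc : ∀ k : ℕ, h (k + 1) - conj ζ * h k = (k + 2) * (g (k + 1) - ζ * g (k + 2))) (k : ℕ) :
    ζ ^ k * h k
      = ∑ j ∈ Finset.range (k + 1), ζ ^ j * g j - (k + 1) * (ζ ^ (k + 1) * g (k + 1)) := by
  have hζ0 : ζ ≠ 0 := norm_ne_zero_iff.mp (hζ ▸ one_ne_zero)
  induction k with
  | zero => simp [h0]
  | succ k ih =>
    have hstep : ζ ^ (k + 1) * h (k + 1) = ζ ^ k * h k
        + ζ ^ (k + 1) * ((k + 2) * (g (k + 1) - ζ * g (k + 2))) := by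
      rw [← hsucc k, ← Complex.inv_eq_conj hζ]
      field_simp
      ring
    rw [hstep, ih, Finset.sum_range_succ _ (k + 1)]
    push_cast
    ring

lemma sum_norm_sq_div_of_recursion (hζ : ‖ζ‖ = 1) (h0 : h 0 = g 0 - ζ * g 1)
    (hsucc : ∀ k : ℕ, h (k + 1) - conj ζ * h k = (k + 2) * (g (k + 1) - ζ * g (k + 2))) (N : ℕ) :
    ∑ k ∈ Finset.range N, ‖h k‖ ^ 2 / ((k + 1) * (k + 2))
      = ∑ k ∈ Finset.range (N + 1), ‖g k‖ ^ 2
        - ‖∑ j ∈ Finset.range (N + 1), ζ ^ j * g j‖ ^ 2 / (N + 1) := by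
  have hnorm (k : ℕ) (w : ℂ) : ‖ζ ^ k * w‖ = ‖w‖ := by rw [norm_mul, norm_pow, hζ, one_pow, one_mul]
  induction N with
  | zero => simp
  | succ N ih =>
    have hlast := norm_sub_ofReal_mul_sq_div (∑ j ∈ Finset.range (N + 1), ζ ^ j * g j)
      (ζ ^ (N + 1) * g (N + 1)) (n := N + 1) (by positivity)
    push_cast at hlast
    rw [← pow_mul_eq_sum_sub_of_recursion hζ h0 hsucc, hnorm, hnorm, ← Finset.sum_range_succ,
      add_assoc (N : ℝ) 1 1, one_add_one_eq_two] at hlast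
    rw [Finset.sum_range_succ, ih, hlast, Finset.sum_range_succ (fun k => ‖g k‖ ^ 2) (N + 1)]
    push_cast
    ring

lemma tsum_norm_sq_div_le_of_recursion (hζ : ‖ζ‖ = 1) (h0 : h 0 = g 0 - ζ * g 1)
    (hsucc : ∀ k : ℕ, h (k + 1) - conj ζ * h k = (k + 2) * (g (k + 1) - ζ * g (k + 2)))
    (hg : Summable fun n => ‖g n‖ ^ 2) :
    ∑' k : ℕ, ENNReal.ofReal (‖h k‖ ^ 2 / ((k + 1) * (k + 2)))
      ≤ ENNReal.ofReal (∑' n, ‖g n‖ ^ 2) := by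
  refine ENNReal.tsum_le_of_sum_range_le fun N => ?_
  rw [← ENNReal.ofReal_sum_of_nonneg (fun _ _ => by positivity),
    sum_norm_sq_div_of_recursion hζ h0 hsucc]
  refine ENNReal.ofReal_le_ofReal ((sub_le_self _ (by positivity)).trans ?_)
  exact hg.sum_le_tsum _ fun _ _ => sq_nonneg _

end Recursion

lemma isHol_deriv_div_one_sub_conj_mul {ζ : ℂ} (hζ : ‖ζ‖ = 1) {f : ℂ → ℂ} (hf : IsHol f) :
    IsHol fun z => deriv f z / (1 - conj ζ * z) :=
  DifferentiableOn.div hf.deriv (by fun_prop) fun _ hz =>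
    one_sub_conj_mul_ne_zero' hζ (mem_ball_zero_iff.mp hz)

lemma dirichletIntegral_eq_tsum {ζ : ℂ} (hζ : ‖ζ‖ = 1) {f : ℂ → ℂ} (hf : IsHol f) :
    dirichletIntegral ζ f = ∑' k : ℕ, ENNReal.ofReal
      (‖taylorCoeff (fun z => deriv f z / (1 - conj ζ * z)) k‖ ^ 2 / ((k + 1) * (k + 2))) := by
  have hweight : ∫⁻ z in ball (0 : ℂ) 1,
      ENNReal.ofReal (‖deriv f z‖ ^ 2 * ((1 - ‖z‖ ^ 2) / ‖z - ζ‖ ^ 2))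
      = ∫⁻ z in ball (0 : ℂ) 1,
        ENNReal.ofReal (‖deriv f z / (1 - conj ζ * z)‖ ^ 2 * (1 - ‖z‖ ^ 2)) := by
    refine setLIntegral_congr_fun isOpen_ball.measurableSet fun z _ => ?_
    simp only [norm_div, norm_one_sub_conj_mul hζ z]
    congr 1
    ring
  rw [dirichletIntegral, hweight,
    lintegral_norm_sq_mul_one_sub_norm_sq (isHol_deriv_div_one_sub_conj_mul hζ hf), ← mul_assoc,
    ← ENNReal.ofReal_mul (by positivity), one_div, inv_mul_cancel₀ Real.pi_ne_zero,
    ENNReal.ofReal_one, one_mul]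

lemma dirichletIntegral_le_tsum {ζ : ℂ} (hζ : ‖ζ‖ = 1) {f : ℂ → ℂ} (hf : IsHol f) {g : ℕ → ℂ}
    (hg : Summable fun n => ‖g n‖ ^ 2)
    (hfg : ∀ n, taylorCoeff f (n + 1) = g n - ζ * g (n + 1)) :
    dirichletIntegral ζ f ≤ ENNReal.ofReal (∑' n, ‖g n‖ ^ 2) := by
  set H : ℂ → ℂ := fun z => deriv f z / (1 - conj ζ * z) with hH
  have hfactor : ∀ z ∈ ball (0 : ℂ) 1, deriv f z = (1 - conj ζ * z) * H z := fun z hz =>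
    (mul_div_cancel₀ _ (one_sub_conj_mul_ne_zero' hζ (mem_ball_zero_iff.mp hz))).symm
  have h0 : taylorCoeff H 0 = g 0 - ζ * g 1 := by
    rw [← hfg]
    simp [taylorCoeff, hH]
  have hsucc (k : ℕ) : taylorCoeff H (k + 1) - conj ζ * taylorCoeff H k
      = (k + 2) * (g (k + 1) - ζ * g (k + 2)) := by
    rw [← taylorCoeff_succ_of_eq_one_sub_mul (isHol_deriv_div_one_sub_conj_mul hζ hf) hfactor,
      taylorCoeff_deriv, hfg]
    push_cast
    ring
  rw [dirichletIntegral_eq_tsum hζ hf]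
  exact tsum_norm_sq_div_le_of_recursion hζ h0 hsucc hg

/-! ### The kernel of `H(b)` and the Schwarz–Pick inequality -/

lemma one_sub_norm_le_norm_sub {ζ : ℂ} (hζ : ‖ζ‖ = 1) (z : ℂ) : 1 - ‖z‖ ≤ ‖z - ζ‖ := by
  rw [← hζ, norm_sub_rev]
  exact norm_sub_norm_le ζ z

lemma one_sub_norm_sq_pos {z : ℂ} (hz : ‖z‖ < 1) : 0 < 1 - ‖z‖ ^ 2 := by
  nlinarith [norm_nonneg z]

lemma norm_one_sub_conj_mul_self {a : ℂ} (ha : ‖a‖ ≤ 1) : ‖1 - conj a * a‖ = 1 - ‖a‖ ^ 2 := by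
  rw [Complex.conj_mul', ← Complex.ofReal_pow, ← Complex.ofReal_one, ← Complex.ofReal_sub,
    Complex.norm_real, Real.norm_of_nonneg (by nlinarith [norm_nonneg a])]

lemma norm_one_sub_conj_mul_sq_sub (a c : ℂ) :
    ‖1 - conj c * a‖ ^ 2 - ‖a - c‖ ^ 2 = (1 - ‖a‖ ^ 2) * (1 - ‖c‖ ^ 2) := by
  simp only [← Complex.normSq_eq_norm_sq, Complex.normSq_apply, Complex.sub_re, Complex.sub_im,
    Complex.mul_re, Complex.mul_im, Complex.conj_re, Complex.conj_im, Complex.one_re,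
    Complex.one_im]
  ring

lemma SchurFunction.norm_apply_le' (b : SchurFunction) {z : ℂ} (hz : ‖z‖ < 1) : ‖b z‖ ≤ 1 :=
  b.norm_apply_le (mem_ball_zero_iff.mpr hz)

lemma SchurFunction.one_sub_norm_sq_nonneg (b : SchurFunction) {z : ℂ} (hz : ‖z‖ < 1) :
    0 ≤ 1 - ‖b z‖ ^ 2 := by
  nlinarith [b.norm_apply_le' hz, norm_nonneg (b z)]

lemma SchurFunction.hasDerivAt (b : SchurFunction) {z : ℂ} (hz : ‖z‖ < 1) :
    HasDerivAt b (deriv b z) z :=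
  (b.isHol.differentiableAt (isOpen_ball.mem_nhds (mem_ball_zero_iff.mpr hz))).hasDerivAt

lemma norm_dbrMatrix_apply (b : SchurFunction) (z w : Complex.UnitDisc) :
    ‖dbrMatrix b z w‖ = ‖dbrKernel b z w‖ := by
  simp [dbrMatrix, norm_smul]

lemma norm_dbrKernel_sq_le (b : SchurFunction) (z w : Complex.UnitDisc) :
    ‖dbrKernel b z w‖ ^ 2 ≤ ‖dbrKernel b z z‖ * ‖dbrKernel b w w‖ := by
  have h := RKHS.norm_kernel_sq_le (DeBrangesRovnyak b) z w
  simpa only [RKHS.OfKernel.kernel_ofKernel, norm_dbrMatrix_apply] using h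

lemma dbrKernel_self (b : ℂ → ℂ) (w : ℂ) :
    dbrKernel b w w = (((1 - ‖b w‖ ^ 2) / (1 - ‖w‖ ^ 2) : ℝ) : ℂ) := by
  unfold dbrKernel
  rw [Complex.conj_mul', Complex.conj_mul']
  push_cast
  rfl

lemma norm_dbrKernel_self (b : SchurFunction) {z : ℂ} (hz : ‖z‖ < 1) :
    ‖dbrKernel b z z‖ = (1 - ‖b z‖ ^ 2) / (1 - ‖z‖ ^ 2) := by
  rw [dbrKernel_self, Complex.norm_real, Real.norm_of_nonneg]
  exact div_nonneg (b.one_sub_norm_sq_nonneg hz) (one_sub_norm_sq_pos hz).le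

lemma norm_one_sub_conj_mul_sq_le (b : SchurFunction) {z w : ℂ} (hz : ‖z‖ < 1) (hw : ‖w‖ < 1) :
    ‖1 - conj (b w) * b z‖ ^ 2 * ((1 - ‖z‖ ^ 2) * (1 - ‖w‖ ^ 2))
      ≤ (1 - ‖b z‖ ^ 2) * (1 - ‖b w‖ ^ 2) * ‖1 - conj w * z‖ ^ 2 := by
  have h := norm_dbrKernel_sq_le b (Complex.UnitDisc.mk z hz) (Complex.UnitDisc.mk w hw)
  simp only [Complex.UnitDisc.coe_mk] at h
  rw [norm_dbrKernel_self b hz, norm_dbrKernel_self b hw, dbrKernel] at h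
  have hzw : 0 < ‖1 - conj w * z‖ := norm_pos_iff.mpr (one_sub_conj_mul_ne_zero hw hz.le)
  have hz2 := one_sub_norm_sq_pos hz
  have hw2 := one_sub_norm_sq_pos hw
  rwa [norm_div, div_pow, div_mul_div_comm, div_le_div_iff₀ (by positivity) (by positivity)] at h

/-- The Schwarz–Pick inequality for pseudohyperbolic distances. -/
lemma norm_sub_mul_le (b : SchurFunction) {z w : ℂ} (hz : ‖z‖ < 1) (hw : ‖w‖ < 1) :
    ‖b z - b w‖ * ‖1 - conj w * z‖ ≤ ‖1 - conj (b w) * b z‖ * ‖z - w‖ := by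
  have h := norm_one_sub_conj_mul_sq_le b hz hw
  rw [← norm_one_sub_conj_mul_sq_sub z w, ← norm_one_sub_conj_mul_sq_sub (b z) (b w)] at h
  refine (abs_le_of_sq_le_sq' ?_ (by positivity)).2
  rw [mul_pow, mul_pow]
  linarith

lemma norm_deriv_mul_le (b : SchurFunction) {w : ℂ} (hw : ‖w‖ < 1) :
    ‖deriv b w‖ * (1 - ‖w‖ ^ 2) ≤ 1 - ‖b w‖ ^ 2 := by
  have hd := b.hasDerivAt hw
  have hc : ContinuousAt b w := hd.continuousAt
  have hslope := (hasDerivAt_iff_tendsto_slope.mp hd).norm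
  have hden : Tendsto (fun z => ‖1 - conj w * z‖) (𝓝[≠] w) (𝓝 ‖1 - conj w * w‖) :=
    ((by fun_prop : Continuous fun z => ‖1 - conj w * z‖).tendsto w).mono_left nhdsWithin_le_nhds
  have hnum : Tendsto (fun z => ‖1 - conj (b w) * b z‖) (𝓝[≠] w) (𝓝 ‖1 - conj (b w) * b w‖) :=
    (by fun_prop : ContinuousAt (fun z => ‖1 - conj (b w) * b z‖) w).tendsto.mono_left
      nhdsWithin_le_nhds
  rw [← norm_one_sub_conj_mul_self hw.le, ← norm_one_sub_conj_mul_self (b.norm_apply_le' hw)]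
  refine le_of_tendsto_of_tendsto (hslope.mul hden) hnum ?_
  filter_upwards [self_mem_nhdsWithin,
    nhdsWithin_le_nhds (isOpen_ball.mem_nhds (mem_ball_zero_iff.mpr hw))] with z hz hzb
  have hz0 : 0 < ‖z - w‖ := norm_pos_iff.mpr (sub_ne_zero.mpr hz)
  rw [slope_def_field, norm_div, div_mul_eq_mul_div, div_le_iff₀ hz0]
  exact norm_sub_mul_le b (mem_ball_zero_iff.mp hzb) hw

lemma isHol_dbrKernel {b : ℂ → ℂ} (hb : IsHol b) {w : ℂ} (hw : ‖w‖ < 1) :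
    IsHol fun z => dbrKernel b z w := by
  unfold dbrKernel
  exact ((differentiableOn_const _).sub (DifferentiableOn.const_mul hb _)).div (by fun_prop)
    fun z hz => one_sub_conj_mul_ne_zero hw (mem_ball_zero_iff.mp hz).le

lemma deriv_dbrKernel_self_mul (b : SchurFunction) {w : ℂ} (hw : ‖w‖ < 1) :
    deriv (fun z => dbrKernel b z w) w * (1 - conj w * w) ^ 2
      = (1 - conj (b w) * b w) * conj w - conj (b w) * (deriv b w * (1 - conj w * w)) := by
  have hne : 1 - conj w * w ≠ 0 := one_sub_conj_mul_ne_zero hw hw.le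
  have hd : HasDerivAt (fun z => dbrKernel b z w)
      (((0 - conj (b w) * deriv b w) * (1 - conj w * w)
        - (1 - conj (b w) * b w) * (0 - conj w * 1)) / (1 - conj w * w) ^ 2) w :=
    ((hasDerivAt_const _ _).sub ((b.hasDerivAt hw).const_mul _)).div
      ((hasDerivAt_const _ _).sub ((hasDerivAt_id w).const_mul _)) hne
  rw [hd.deriv, div_mul_cancel₀ _ (pow_ne_zero 2 hne)]
  ring

lemma le_norm_deriv_dbrKernel (b : SchurFunction) {w : ℂ} (hw : ‖w‖ < 1) :
    (1 - ‖b w‖ ^ 2) * (‖w‖ - ‖b w‖)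
      ≤ ‖deriv (fun z => dbrKernel b z w) w‖ * (1 - ‖w‖ ^ 2) ^ 2 := by
  have hpick := mul_le_mul_of_nonneg_left (norm_deriv_mul_le b hw) (norm_nonneg (b w))
  calc (1 - ‖b w‖ ^ 2) * (‖w‖ - ‖b w‖)
      ≤ (1 - ‖b w‖ ^ 2) * ‖w‖ - ‖b w‖ * (‖deriv b w‖ * (1 - ‖w‖ ^ 2)) := by linarith
    _ = ‖(1 - conj (b w) * b w) * conj w‖
          - ‖conj (b w) * (deriv b w * (1 - conj w * w))‖ := by
        simp only [norm_mul, norm_one_sub_conj_mul_self hw.le,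
          norm_one_sub_conj_mul_self (b.norm_apply_le' hw), RCLike.norm_conj]
    _ ≤ ‖(1 - conj (b w) * b w) * conj w - conj (b w) * (deriv b w * (1 - conj w * w))‖ :=
        norm_sub_norm_le _ _
    _ = ‖deriv (fun z => dbrKernel b z w) w‖ * (1 - ‖w‖ ^ 2) ^ 2 := by
        rw [← deriv_dbrKernel_self_mul b hw, norm_mul, norm_pow, norm_one_sub_conj_mul_self hw.le]

/-! ### Necessity -/

lemma dirichletIntegral_congr {f g : ℂ → ℂ} (ζ : ℂ) (h : EqOn f g (ball 0 1)) :
    dirichletIntegral ζ f = dirichletIntegral ζ g := by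
  unfold dirichletIntegral
  congr 1
  refine setLIntegral_congr_fun measurableSet_ball fun z hz => ?_
  rw [(h.eventuallyEq_of_mem (isOpen_ball.mem_nhds hz)).deriv_eq]

lemma norm_lt_of_mem_ball_half {w z : ℂ} (hz : z ∈ ball w ((1 - ‖w‖) / 2)) :
    ‖z‖ < 1 - (1 - ‖w‖) / 2 := by
  rw [mem_ball_iff_norm] at hz
  have h : ‖z‖ ≤ ‖z - w‖ + ‖w‖ := by simpa using norm_add_le (z - w) w
  linarith

lemma div_le_one_sub_norm_sq_div {ζ : ℂ} (hζ : ‖ζ‖ = 1) {w z : ℂ} (hw : ‖w‖ < 1)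
    (hz : z ∈ ball w ((1 - ‖w‖) / 2)) :
    (1 - ‖w‖) / (8 * ‖w - ζ‖ ^ 2) ≤ (1 - ‖z‖ ^ 2) / ‖z - ζ‖ ^ 2 := by
  have hz1 := norm_lt_of_mem_ball_half hz
  have hwζ := one_sub_norm_le_norm_sub hζ w
  have hzζ : 0 < ‖z - ζ‖ := by linarith [one_sub_norm_le_norm_sub hζ z]
  have htri : ‖z - ζ‖ ≤ 2 * ‖w - ζ‖ := by
    have h : ‖z - ζ‖ ≤ ‖z - w‖ + ‖w - ζ‖ := norm_sub_le_norm_sub_add_norm_sub z w ζ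
    linarith [mem_ball_iff_norm.mp hz]
  calc (1 - ‖w‖) / (8 * ‖w - ζ‖ ^ 2) = (1 - ‖w‖) / 2 / (2 * ‖w - ζ‖) ^ 2 := by field_simp; ring
    _ ≤ (1 - ‖z‖ ^ 2) / ‖z - ζ‖ ^ 2 := by
      refine div_le_div₀ ?_ ?_ (by positivity) (pow_le_pow_left₀ hzζ.le htri 2) <;>
        nlinarith [norm_nonneg z]

/-- The mean value inequality on a disk of fixed hyperbolic size around `w`, where the weight of
`D_ζ` is comparable to its value at `w`. -/
lemma ofReal_le_dirichletIntegral {ζ : ℂ} (hζ : ‖ζ‖ = 1) {f : ℂ → ℂ} (hf : IsHol f) {w : ℂ}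
    (hw : ‖w‖ < 1) :
    ENNReal.ofReal ((1 - ‖w‖) ^ 3 * ‖deriv f w‖ ^ 2 / (32 * ‖w - ζ‖ ^ 2))
      ≤ dirichletIntegral ζ f := by
  have hd : 0 < 1 - ‖w‖ := sub_pos.mpr hw
  have hwζ : 0 < ‖w - ζ‖ := hd.trans_le (one_sub_norm_le_norm_sub hζ w)
  set D := ball w ((1 - ‖w‖) / 2)
  have hsub : D ⊆ ball 0 1 := fun z hz =>
    mem_ball_zero_iff.mpr (by linarith [norm_lt_of_mem_ball_half hz])
  have hmean := norm_sq_mul_area_le (c := w) (R := (1 - ‖w‖) / 2) (by linarith) (hf.deriv.mono hsub)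
  have hweight : ENNReal.ofReal ((1 - ‖w‖) / (8 * ‖w - ζ‖ ^ 2)) *
      ∫⁻ z in D, ENNReal.ofReal (‖deriv f z‖ ^ 2)
      ≤ ∫⁻ z in ball (0 : ℂ) 1,
        ENNReal.ofReal (‖deriv f z‖ ^ 2 * ((1 - ‖z‖ ^ 2) / ‖z - ζ‖ ^ 2)) := by
    rw [← lintegral_const_mul' _ _ ENNReal.ofReal_ne_top]
    refine le_trans (setLIntegral_mono' measurableSet_ball fun z hz => ?_)
      (lintegral_mono_set hsub)
    rw [← ENNReal.ofReal_mul (by positivity), mul_comm]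
    exact ENNReal.ofReal_le_ofReal
      (mul_le_mul_of_nonneg_left (div_le_one_sub_norm_sq_div hζ hw hz) (sq_nonneg _))
  unfold dirichletIntegral
  refine le_trans ?_ (mul_le_mul_right ((mul_le_mul_right hmean _).trans hweight) _)
  rw [← ENNReal.ofReal_mul (by positivity), ← ENNReal.ofReal_mul (by positivity)]
  refine ENNReal.ofReal_le_ofReal (le_of_eq ?_)
  field_simp
  ring

lemma exists_frequently_norm_lt_of_mem_boundarySpectrum {b : ℂ → ℂ} {ζ : ℂ}
    (h : ζ ∈ boundarySpectrum b) :
    ∃ c : ℝ, 0 ≤ c ∧ c < 1 ∧ ∃ᶠ z in 𝓝[ball 0 1] ζ, ‖b z‖ < c := by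
  obtain ⟨c, hbc, hc⟩ := exists_between h.2
  have hc_top : c ≠ ∞ := (hc.trans ENNReal.one_lt_top).ne
  refine ⟨c.toReal, ENNReal.toReal_nonneg, ?_, ?_⟩
  · simpa using (ENNReal.toReal_lt_toReal hc_top ENNReal.one_ne_top).mpr hc
  · refine (frequently_lt_of_liminf_lt (by isBoundedDefault) hbc).mono fun z hz => ?_
    simpa using (ENNReal.toReal_lt_toReal enorm_ne_top hc_top).mpr hz

lemma sq_le_of_dirichletIntegral_dbrKernel_le {ζ : ℂ} (hζ : ‖ζ‖ = 1) (b : SchurFunction) {C : ℝ≥0}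
    {w : ℂ} (hw : ‖w‖ < 1) (hbw : ‖b w‖ ≤ ‖w‖)
    (h : dirichletIntegral ζ (fun z => dbrKernel b z w)
      ≤ C * ENNReal.ofReal ((1 - ‖b w‖ ^ 2) / (1 - ‖w‖ ^ 2))) :
    ((1 - ‖b w‖ ^ 2) * (‖w‖ - ‖b w‖)) ^ 2 ≤ 512 * C * ‖w - ζ‖ ^ 2 := by
  have hup := (ofReal_le_dirichletIntegral hζ (isHol_dbrKernel b.isHol hw) hw).trans h
  have hbw0 := b.one_sub_norm_sq_nonneg hw
  have hw2 := one_sub_norm_sq_pos hw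
  rw [← ENNReal.ofReal_coe_nnreal, ← ENNReal.ofReal_mul C.coe_nonneg,
    ENNReal.ofReal_le_ofReal_iff (by positivity)] at hup
  have hder := le_norm_deriv_dbrKernel b hw
  set X := ‖deriv (fun z => dbrKernel b z w) w‖
  have hX0 : 0 ≤ X := norm_nonneg _
  obtain ⟨d, hwd⟩ : ∃ d, ‖w‖ = 1 - d := ⟨1 - ‖w‖, by ring⟩
  rw [hwd] at hw2 hw
  have hd0 : 0 < d := by linarith
  have hwζ : 0 < ‖w - ζ‖ := by linarith [one_sub_norm_le_norm_sub hζ w]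
  have hd2 : (1 - ‖w‖ ^ 2) ^ 2 ≤ 4 * d ^ 2 := by rw [hwd]; nlinarith
  have hker : (1 - ‖b w‖ ^ 2) / (1 - ‖w‖ ^ 2) ≤ 1 / d :=
    div_le_div₀ zero_le_one (by nlinarith [norm_nonneg (b w)]) hd0
      (by nlinarith [norm_nonneg w])
  have hX : d ^ 3 * X ^ 2 / (32 * ‖w - ζ‖ ^ 2) ≤ C * (1 / d) := by
    simpa only [hwd, sub_sub_cancel] using hup.trans (mul_le_mul_of_nonneg_left hker C.coe_nonneg)
  rw [mul_one_div, div_le_div_iff₀ (by positivity) hd0] at hX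
  calc ((1 - ‖b w‖ ^ 2) * (‖w‖ - ‖b w‖)) ^ 2
      ≤ (X * (4 * d ^ 2)) ^ 2 := pow_le_pow_left₀ (mul_nonneg hbw0 (by linarith))
        (hder.trans (mul_le_mul_of_nonneg_left hd2 hX0)) 2
    _ ≤ 512 * C * ‖w - ζ‖ ^ 2 := by linarith

lemma notMem_boundarySpectrum_of_kernel_bound {ζ : ℂ} (hζ : ‖ζ‖ = 1) (b : SchurFunction) (C : ℝ≥0)
    (h : ∀ w : ℂ, ‖w‖ < 1 → dirichletIntegral ζ (fun z => dbrKernel b z w)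
      ≤ C * ENNReal.ofReal ((1 - ‖b w‖ ^ 2) / (1 - ‖w‖ ^ 2))) :
    ζ ∉ boundarySpectrum b := by
  intro hmem
  obtain ⟨c, hc0, hc1, hfreq⟩ := exists_frequently_norm_lt_of_mem_boundarySpectrum hmem
  set κ := (1 - c ^ 2) * ((1 - c) / 2) with hκ
  have hκ0 : 0 < κ := mul_pos (by nlinarith) (by linarith)
  have hnorm : ∀ᶠ z in 𝓝 ζ, (1 + c) / 2 < ‖z‖ :=
    continuous_norm.continuousAt.eventually_const_lt (show _ < ‖ζ‖ by linarith)
  have hsmall : ∀ᶠ z in 𝓝 ζ, 512 * C * ‖z - ζ‖ ^ 2 < κ ^ 2 := by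
    have : ContinuousAt (fun z => 512 * (C : ℝ) * ‖z - ζ‖ ^ 2) ζ := by fun_prop
    refine this.eventually_lt_const ?_
    simpa using pow_pos hκ0 2
  obtain ⟨w, hbw, hwb, hw, hwκ⟩ := (hfreq.and_eventually (eventually_mem_nhdsWithin.and
    ((hnorm.and hsmall).filter_mono nhdsWithin_le_nhds))).exists
  have hw1 := mem_ball_zero_iff.mp hwb
  have hb0 := norm_nonneg (b w)
  have hκw : κ ≤ (1 - ‖b w‖ ^ 2) * (‖w‖ - ‖b w‖) :=
    mul_le_mul (by nlinarith) (by linarith) (by linarith) (by nlinarith)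
  exact hwκ.not_ge ((pow_le_pow_left₀ hκ0.le hκw 2).trans
    (sq_le_of_dirichletIntegral_dbrKernel_le hζ b hw1 (by linarith) (h w hw1)))

/-! ### Harnack's inequality and approximation on the circle -/

lemma exists_differentiable_of_mem_span_fourier {g : C(AddCircle (2 * π), ℂ)}
    (hg : g ∈ Submodule.span ℂ (range (fourier (T := 2 * π)))) :
    ∃ p₁ p₂ : ℂ → ℂ, Differentiable ℂ p₁ ∧ Differentiable ℂ p₂ ∧
      ∀ x, g x = p₁ (AddCircle.toCircle x) + conj (p₂ (AddCircle.toCircle x)) := by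
  induction hg using Submodule.span_induction with
  | mem g hg =>
    obtain ⟨n, rfl⟩ := hg
    rcases Int.eq_nat_or_neg n with ⟨m, rfl | rfl⟩
    · refine ⟨fun z => z ^ m, fun _ => 0, by fun_prop, by fun_prop, fun x => ?_⟩
      simp [fourier_apply, AddCircle.toCircle_nsmul]
    · refine ⟨fun _ => 0, fun z => z ^ m, by fun_prop, by fun_prop, fun x => ?_⟩
      simp [fourier_apply, AddCircle.toCircle_nsmul, AddCircle.toCircle_neg,
        ← Circle.coe_inv_eq_conj]
  | zero => exact ⟨fun _ => 0, fun _ => 0, by fun_prop, by fun_prop, fun x => by simp⟩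
  | add g₁ g₂ _ _ h₁ h₂ =>
    obtain ⟨p₁, p₂, hp₁, hp₂, hp⟩ := h₁
    obtain ⟨r₁, r₂, hr₁, hr₂, hr⟩ := h₂
    refine ⟨fun z => p₁ z + r₁ z, fun z => p₂ z + r₂ z, by fun_prop, by fun_prop, fun x => ?_⟩
    simp only [ContinuousMap.add_apply, hp, hr, map_add]
    ring
  | smul c g _ h =>
    obtain ⟨p₁, p₂, hp₁, hp₂, hp⟩ := h
    refine ⟨fun z => c * p₁ z, fun z => conj c * p₂ z, by fun_prop, by fun_prop, fun x => ?_⟩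
    simp only [ContinuousMap.smul_apply, hp, map_mul, Complex.conj_conj, smul_eq_mul]
    ring

lemma exists_differentiable_re_approx {q : ℂ → ℝ} (hq : ContinuousOn q (sphere 0 1)) {δ : ℝ}
    (hδ : 0 < δ) :
    ∃ p : ℂ → ℂ, Differentiable ℂ p ∧ ∀ z ∈ sphere (0 : ℂ) 1, |(p z).re - q z| ≤ δ := by
  have : Fact (0 < 2 * π) := ⟨by positivity⟩
  have hc : Continuous fun x : AddCircle (2 * π) => (q (AddCircle.toCircle x) : ℂ) :=
    Complex.continuous_ofReal.comp (hq.comp_continuous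
      (continuous_subtype_val.comp AddCircle.continuous_toCircle)
      fun x => mem_sphere_zero_iff_norm.mpr (Circle.norm_coe _))
  set Q : C(AddCircle (2 * π), ℂ) := ⟨_, hc⟩ with hQ
  have hmem : Q ∈ closure ((Submodule.span ℂ (range (fourier (T := 2 * π))) :
      Submodule ℂ _) : Set C(AddCircle (2 * π), ℂ)) := by
    rw [← Submodule.topologicalClosure_coe, span_fourier_closure_eq_top]
    trivial
  obtain ⟨g, hg, hgQ⟩ := Metric.mem_closure_iff.mp hmem δ hδ
  obtain ⟨p₁, p₂, hp₁, hp₂, hp⟩ := exists_differentiable_of_mem_span_fourier hg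
  refine ⟨fun z => p₁ z + p₂ z, by fun_prop, fun z hz => ?_⟩
  obtain ⟨x, hx⟩ := (AddCircle.homeomorphCircle (T := 2 * π) (by positivity)).surjective
    ⟨z, by simpa [Submonoid.unitSphere] using hz⟩
  have hxz : (AddCircle.toCircle x : ℂ) = z := by
    rw [← AddCircle.homeomorphCircle_apply (by positivity), hx]
  have hre : (p₁ z + p₂ z).re - q z = -(Q x - g x).re := by
    rw [hp x, hxz]
    simp [hQ, hxz]
  rw [hre, abs_neg]
  refine (Complex.abs_re_le_norm _).trans ?_
  rw [← dist_eq_norm]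
  exact (ContinuousMap.dist_apply_le_dist x).trans hgQ.le

lemma circleAverage_re {p : ℂ → ℂ} {c : ℂ} {R : ℝ} (hp : CircleIntegrable p c R) :
    Real.circleAverage (fun z => (p z).re) c R = (Real.circleAverage p c R).re :=
  Complex.reCLM.circleAverage_comp_comm hp

lemma continuousOn_sphere_of_diffContOnCl {p : ℂ → ℂ} (hp : DiffContOnCl ℂ p (ball 0 1)) :
    ContinuousOn p (sphere 0 1) :=
  hp.continuousOn_ball.mono sphere_subset_closedBall

lemma continuousOn_poissonKernel {w : ℂ} (hw : w ∈ ball (0 : ℂ) 1) :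
    ContinuousOn (poissonKernel 0 w) (sphere 0 1) := by
  rw [poissonKernel_eq_re_herglotzRieszKernel]
  simpa using Complex.continuous_re.comp_continuousOn (continuousOn_herglotzRieszKernel_sphere hw)

lemma re_eq_circleAverage_poissonKernel {p : ℂ → ℂ} (hp : DiffContOnCl ℂ p (ball 0 1)) {w : ℂ}
    (hw : w ∈ ball (0 : ℂ) 1) :
    (p w).re = Real.circleAverage (fun z => poissonKernel 0 w z * (p z).re) 0 1 := by
  have hcont : ContinuousOn (poissonKernel 0 w • p) (sphere 0 1) :=
    (continuousOn_poissonKernel hw).smul (continuousOn_sphere_of_diffContOnCl hp)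
  rw [← hp.circleAverage_poissonKernel_smul hw,
    ← circleAverage_re (hcont.circleIntegrable zero_le_one)]
  simp

lemma poissonKernel_mem_Icc {w z : ℂ} (hw : w ∈ ball (0 : ℂ) 1) (hz : z ∈ sphere (0 : ℂ) 1) :
    poissonKernel 0 w z ∈ Icc 0 ((1 + ‖w‖) / (1 - ‖w‖)) := by
  have hw1 : 0 < 1 - ‖w‖ := sub_pos.mpr (mem_ball_zero_iff.mp hw)
  rw [poissonKernel_eq_re_herglotzRieszKernel]
  have hle := le_re_herglotzRieszKernel hz hw
  have hge := re_herglotzRieszKernel_le hz hw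
  simp only [sub_zero] at hle hge
  have h0 : 0 ≤ (1 - ‖w‖) / (1 + ‖w‖) := by positivity
  simpa only [Function.comp_apply, herglotzRieszKernel_def, sub_zero, mem_Icc]
    using And.intro (h0.trans hle) hge

lemma re_nonneg_of_sphere {p : ℂ → ℂ} (hp : DiffContOnCl ℂ p (ball 0 1))
    (h0 : ∀ z ∈ sphere (0 : ℂ) 1, 0 ≤ (p z).re) {w : ℂ} (hw : w ∈ closedBall (0 : ℂ) 1) :
    0 ≤ (p w).re := by
  rcases (mem_closedBall_zero_iff.mp hw).lt_or_eq with hlt | heq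
  · have hwb := mem_ball_zero_iff.mpr hlt
    rw [re_eq_circleAverage_poissonKernel hp hwb]
    refine Real.circleAverage_nonneg_of_nonneg fun z hz => ?_
    rw [abs_one] at hz
    exact mul_nonneg (poissonKernel_mem_Icc hwb hz).1 (h0 z hz)
  · exact h0 w (mem_sphere_zero_iff_norm.mpr heq)

/-- Harnack's inequality. -/
lemma re_le_mul_circleAverage {p : ℂ → ℂ} (hp : DiffContOnCl ℂ p (ball 0 1))
    (h0 : ∀ z ∈ sphere (0 : ℂ) 1, 0 ≤ (p z).re) {w : ℂ} (hw : w ∈ ball (0 : ℂ) 1) :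
    (p w).re ≤ (1 + ‖w‖) / (1 - ‖w‖) * Real.circleAverage (fun z => (p z).re) 0 1 := by
  have hre : ContinuousOn (fun z => (p z).re) (sphere 0 1) :=
    Complex.continuous_re.comp_continuousOn (continuousOn_sphere_of_diffContOnCl hp)
  rw [re_eq_circleAverage_poissonKernel hp hw, ← smul_eq_mul, ← Real.circleAverage_fun_smul]
  refine Real.circleAverage_mono
    (((continuousOn_poissonKernel hw).mul hre).circleIntegrable zero_le_one)
    (ContinuousOn.circleIntegrable zero_le_one (by fun_prop)) fun z hz => ?_
  rw [abs_one] at hz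
  exact mul_le_mul_of_nonneg_right (poissonKernel_mem_Icc hw hz).2 (h0 z hz)

/-! ### A barrier estimate for the modulus near a unimodular boundary arc -/

lemma two_mul_re_one_sub (a : ℂ) : 2 * (1 - a).re = ‖1 - a‖ ^ 2 + (1 - ‖a‖ ^ 2) := by
  simp only [← Complex.normSq_eq_norm_sq, Complex.normSq_apply, Complex.sub_re, Complex.sub_im,
    Complex.one_re, Complex.one_im]
  ring

lemma neg_log_norm_le_re_of_frontier {U : Set ℂ} (hU : Bornology.IsBounded U) {g h : ℂ → ℂ}
    (hg : DiffContOnCl ℂ g U) (hh : DiffContOnCl ℂ h U) (hg0 : ∀ w ∈ closure U, g w ≠ 0)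
    (hfr : ∀ w ∈ frontier U, -Real.log ‖g w‖ ≤ (h w).re) {z : ℂ} (hz : z ∈ closure U) :
    -Real.log ‖g z‖ ≤ (h z).re := by
  have hnorm : ∀ w ∈ closure U,
      ‖Complex.exp (-h w) • (g w)⁻¹‖ = Real.exp (-Real.log ‖g w‖ - (h w).re) := fun w hw => by
    rw [norm_smul, Complex.norm_exp, norm_inv, Real.exp_sub, Real.exp_neg (Real.log _),
      Real.exp_log (norm_pos_iff.mpr (hg0 w hw)), Complex.neg_re, Real.exp_neg, mul_comm,
      div_eq_mul_inv]
  have hmax := Complex.norm_le_of_forall_mem_frontier_norm_le hU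
    ((Complex.differentiable_exp.comp_diffContOnCl hh.neg).smul (hg.inv hg0))
    (C := 1) (fun w hw => ?_) hz
  · simpa using (hnorm z hz).symm.trans_le hmax
  · exact (hnorm w (frontier_subset_closure hw)).trans_le (by simpa using hfr w hw)

lemma frontier_ball_inter_ball_subset {c z₀ : ℂ} {R δ : ℝ} (hR : R ≠ 0) (hδ : δ ≠ 0) :
    frontier (ball c R ∩ ball z₀ δ) ⊆
      sphere c R ∩ closedBall z₀ δ ∪ closedBall c R ∩ sphere z₀ δ := by
  simpa only [frontier_ball _ hR, frontier_ball _ hδ, closure_ball _ hR, closure_ball _ hδ]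
    using frontier_inter_subset (ball c R) (ball z₀ δ)

lemma closure_ball_inter_ball_subset (c z₀ : ℂ) (R δ : ℝ) :
    closure (ball c R ∩ ball z₀ δ) ⊆ closedBall c R ∩ closedBall z₀ δ :=
  closure_minimal (inter_subset_inter ball_subset_closedBall ball_subset_closedBall)
    (isClosed_closedBall.inter isClosed_closedBall)

/-- The barrier is `2 L / δ² * Re (1 - conj z₀ * w)`, which is at least `L` on the part of the
frontier inside the disk. -/
lemma neg_log_norm_le_of_barrier {g p : ℂ → ℂ} {z₀ : ℂ} (hz₀ : ‖z₀‖ = 1) {δ L : ℝ} (hδ : 0 < δ)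
    (hL : 0 ≤ L) (hg : DiffContOnCl ℂ g (ball 0 1 ∩ ball z₀ δ))
    (hg0 : ∀ w ∈ closedBall 0 1 ∩ closedBall z₀ δ, g w ≠ 0)
    (hgL : ∀ w ∈ closedBall 0 1 ∩ closedBall z₀ δ, -Real.log ‖g w‖ ≤ L)
    (hp : DiffContOnCl ℂ p (ball 0 1)) (hp0 : ∀ w ∈ sphere (0 : ℂ) 1, 0 ≤ (p w).re)
    (hgp : ∀ w ∈ sphere 0 1 ∩ closedBall z₀ δ, -Real.log ‖g w‖ ≤ (p w).re)
    {z : ℂ} (hz : z ∈ ball 0 1 ∩ ball z₀ δ) :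
    -Real.log ‖g z‖ ≤ L / δ ^ 2 * (‖z - z₀‖ ^ 2 + (1 - ‖z‖ ^ 2)) + (p z).re := by
  set h : ℂ → ℂ := fun w => ((2 * L / δ ^ 2 : ℝ) : ℂ) * (1 - conj z₀ * w) + p w
  have hlin : Differentiable ℂ fun w => ((2 * L / δ ^ 2 : ℝ) : ℂ) * (1 - conj z₀ * w) := by
    fun_prop
  have hre : ∀ w, (h w).re = L / δ ^ 2 * (‖w - z₀‖ ^ 2 + (1 - ‖w‖ ^ 2)) + (p w).re := fun w => by
    have h2 := two_mul_re_one_sub (conj z₀ * w)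
    rw [norm_one_sub_conj_mul hz₀, norm_mul, RCLike.norm_conj, hz₀, one_mul] at h2
    rw [Complex.add_re, Complex.re_ofReal_mul, ← h2]
    ring
  rw [← hre]
  refine neg_log_norm_le_re_of_frontier (isBounded_ball.subset inter_subset_left) hg
    (h := h) (hlin.diffContOnCl.add (hp.mono inter_subset_left))
    (fun w hw => hg0 w (closure_ball_inter_ball_subset _ _ _ _ hw)) (fun w hw => ?_)
    (subset_closure hz)
  rw [hre]
  rcases frontier_ball_inter_ball_subset one_ne_zero hδ.ne' hw with hw | hw
  · have hw1 : ‖w‖ = 1 := mem_sphere_zero_iff_norm.mp hw.1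
    have hbar : 0 ≤ L / δ ^ 2 * (‖w - z₀‖ ^ 2 + (1 - ‖w‖ ^ 2)) := by
      rw [hw1, one_pow, sub_self, add_zero]
      positivity
    linarith [hgp w hw]
  · have hw1 : ‖w‖ ^ 2 ≤ 1 := pow_le_one₀ (norm_nonneg _) (mem_closedBall_zero_iff.mp hw.1)
    have hbar : L ≤ L / δ ^ 2 * (‖w - z₀‖ ^ 2 + (1 - ‖w‖ ^ 2)) := by
      rw [mem_sphere_iff_norm.mp hw.2]
      calc L = L / δ ^ 2 * δ ^ 2 := by field_simp
        _ ≤ _ := mul_le_mul_of_nonneg_left (by linarith) (by positivity)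
    linarith [hgL w ⟨hw.1, sphere_subset_closedBall hw.2⟩, re_nonneg_of_sphere hp hp0 hw.1]

lemma neg_log_norm_le_of_barrier_circleAverage {g : ℂ → ℂ} {q : ℂ → ℝ} {z₀ : ℂ} (hz₀ : ‖z₀‖ = 1)
    {δ L : ℝ} (hδ : 0 < δ) (hL : 0 ≤ L) (hg : DiffContOnCl ℂ g (ball 0 1 ∩ ball z₀ δ))
    (hg0 : ∀ w ∈ closedBall 0 1 ∩ closedBall z₀ δ, g w ≠ 0)
    (hgL : ∀ w ∈ closedBall 0 1 ∩ closedBall z₀ δ, -Real.log ‖g w‖ ≤ L)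
    (hq : ContinuousOn q (sphere 0 1)) (hq0 : ∀ w ∈ sphere (0 : ℂ) 1, 0 ≤ q w)
    (hgq : ∀ w ∈ sphere 0 1 ∩ closedBall z₀ δ, -Real.log ‖g w‖ ≤ q w)
    {z : ℂ} (hz : z ∈ ball 0 1 ∩ ball z₀ δ) :
    -Real.log ‖g z‖ ≤ L / δ ^ 2 * (‖z - z₀‖ ^ 2 + (1 - ‖z‖ ^ 2))
      + (1 + ‖z‖) / (1 - ‖z‖) * Real.circleAverage q 0 1 := by
  have hz1 : 0 < 1 - ‖z‖ := sub_pos.mpr (mem_ball_zero_iff.mp hz.1)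
  set K := (1 + ‖z‖) / (1 - ‖z‖)
  have hK : 0 < K := by positivity
  refine le_of_forall_pos_le_add fun η hη => ?_
  have hη' : 0 < η / (2 * K) := by positivity
  obtain ⟨p, hp, hpq⟩ := exists_differentiable_re_approx
    (q := fun w => q w + η / (2 * K)) (hq.add continuousOn_const) hη'
  have hqp : ∀ w ∈ sphere (0 : ℂ) 1, q w ≤ (p w).re := fun w hw => by
    linarith [(abs_le.mp (hpq w hw)).1]
  have hpq' : ∀ w ∈ sphere (0 : ℂ) 1, (p w).re ≤ q w + η / K := fun w hw => by
    have : η / K = 2 * (η / (2 * K)) := by field_simp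
    linarith [(abs_le.mp (hpq w hw)).2]
  have hp0 : ∀ w ∈ sphere (0 : ℂ) 1, 0 ≤ (p w).re := fun w hw => (hq0 w hw).trans (hqp w hw)
  have havg : Real.circleAverage (fun w => (p w).re) 0 1 ≤ Real.circleAverage q 0 1 + η / K := by
    have hqi := hq.circleIntegrable (c := 0) zero_le_one
    have hci : CircleIntegrable (fun _ => η / K) (0 : ℂ) 1 := circleIntegrable_const _ _ _
    rw [← Real.circleAverage_const (η / K) 0 1, ← Real.circleAverage_fun_add hqi hci]
    refine Real.circleAverage_mono ?_ (hqi.add hci) fun w hw => hpq' w (by simpa using hw)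
    exact (Complex.continuous_re.comp hp.continuous).continuousOn.circleIntegrable zero_le_one
  calc -Real.log ‖g z‖
      ≤ L / δ ^ 2 * (‖z - z₀‖ ^ 2 + (1 - ‖z‖ ^ 2)) + (p z).re :=
        neg_log_norm_le_of_barrier hz₀ hδ hL hg hg0 hgL hp.diffContOnCl hp0
          (fun w hw => (hgq w hw).trans (hqp w hw.1)) hz
    _ ≤ L / δ ^ 2 * (‖z - z₀‖ ^ 2 + (1 - ‖z‖ ^ 2)) + K * (Real.circleAverage q 0 1 + η / K) := by
        gcongr
        exact (re_le_mul_circleAverage hp.diffContOnCl hp0 hz.1).trans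
          (mul_le_mul_of_nonneg_left havg hK.le)
    _ = _ := by rw [mul_add K, mul_div_cancel₀ _ hK.ne', add_assoc]

lemma neg_log_max_half_mem_Icc {t : ℝ} (ht : t ≤ 1) :
    -Real.log (max (1 / 2) t) ∈ Icc 0 (Real.log 2) := by
  have hpos : 0 < max (1 / 2) t := lt_max_of_lt_left (by norm_num)
  constructor
  · exact neg_nonneg.mpr (Real.log_nonpos hpos.le (max_le (by norm_num) ht))
  · rw [← Real.log_inv]
    exact Real.log_le_log (inv_pos.mpr hpos) ((inv_le_comm₀ hpos two_pos).mpr (by simp))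

/-- The boundary datum `-log |b(s w)|` at radius `s`, truncated at `log 2` and cut off to the
ball carrying `χ`. -/
def cutoffNegLog (b : SchurFunction) {ζ : ℂ} (χ : ContDiffBump ζ) (s : ℝ) (w : ℂ) : ℝ :=
  χ w * -Real.log (max (1 / 2) ‖b (s * w)‖)

section UnimodularArc

variable {b : SchurFunction} {ζ : ℂ} {χ : ContDiffBump ζ} {s : ℝ}

lemma cutoffNegLog_mem_Icc (hs : s ∈ Ioo 0 1) {w : ℂ} (hw : ‖w‖ ≤ 1) :
    cutoffNegLog b χ s w ∈ Icc 0 (Real.log 2) := by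
  obtain ⟨h0, h1⟩ :=
    neg_log_max_half_mem_Icc (b.norm_apply_le (ofReal_mul_mem_ball hs.1.le hs.2 hw))
  exact ⟨mul_nonneg χ.nonneg h0, (mul_le_of_le_one_left h0 χ.le_one).trans h1⟩

lemma continuousOn_cutoffNegLog (hs : s ∈ Ioo 0 1) :
    ContinuousOn (cutoffNegLog b χ s) (sphere 0 1) := by
  have hb : ContinuousOn (fun w : ℂ => b (s * w)) (sphere 0 1) :=
    b.isHol.continuousOn.comp (by fun_prop) fun w hw =>
      ofReal_mul_mem_ball hs.1.le hs.2 (mem_sphere_zero_iff_norm.mp hw).le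
  refine χ.continuous.continuousOn.mul (ContinuousOn.neg ?_)
  exact (continuousOn_const.sup hb.norm).log fun w _ =>
    (lt_max_of_lt_left (by norm_num : (0 : ℝ) < 1 / 2)).ne'

lemma tendsto_cutoffNegLog {w : ℂ} (hw : ‖w - ζ‖ < χ.rOut →
    Tendsto (fun s : ℝ => ‖b (s * w)‖) (𝓝[<] 1) (𝓝 1)) :
    Tendsto (fun s => cutoffNegLog b χ s w) (𝓝[<] 1) (𝓝 0) := by
  rcases lt_or_ge ‖w - ζ‖ χ.rOut with hlt | hge
  · have hmax := (tendsto_const_nhds (x := (1 / 2 : ℝ))).max (hw hlt)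
    rw [max_eq_right (by norm_num : (1 / 2 : ℝ) ≤ 1)] at hmax
    simpa [cutoffNegLog] using (hmax.log one_ne_zero).neg.const_mul (χ w)
  · have hzero : χ w = 0 := χ.zero_of_le_dist (by rwa [dist_eq_norm])
    simp only [cutoffNegLog, hzero, zero_mul]
    exact tendsto_const_nhds

lemma tendsto_circleAverage_cutoffNegLog
    (hlim : ∀ᵐ θ : ℝ, ‖circleMap 0 1 θ - ζ‖ < χ.rOut →
      Tendsto (fun s : ℝ => ‖b (s * circleMap 0 1 θ)‖) (𝓝[<] 1) (𝓝 1)) :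
    Tendsto (fun s => Real.circleAverage (cutoffNegLog b χ s) 0 1) (𝓝[<] 1) (𝓝 0) := by
  have hIoo : Ioo (0 : ℝ) 1 ∈ 𝓝[<] (1 : ℝ) := Ioo_mem_nhdsLT zero_lt_one
  have hint : Tendsto
      (fun s => ∫ θ in (0 : ℝ)..2 * π, cutoffNegLog b χ s (circleMap 0 1 θ)) (𝓝[<] 1)
      (𝓝 (∫ _ in (0 : ℝ)..2 * π, (0 : ℝ))) := by
    refine intervalIntegral.tendsto_integral_filter_of_dominated_convergence
      (fun _ => Real.log 2) ?_ ?_ intervalIntegrable_const ?_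
    · filter_upwards [hIoo] with s hs
      exact ((continuousOn_cutoffNegLog hs).comp_continuous (continuous_circleMap 0 1)
        fun θ => circleMap_mem_sphere _ zero_le_one θ).aestronglyMeasurable
    · filter_upwards [hIoo] with s hs
      refine .of_forall fun θ _ => ?_
      obtain ⟨h0, h1⟩ := cutoffNegLog_mem_Icc (b := b) (χ := χ) hs (w := circleMap 0 1 θ) (by simp)
      rwa [Real.norm_of_nonneg h0]
    · filter_upwards [hlim] with θ hθ _ using tendsto_cutoffNegLog hθ
  simpa [Real.circleAverage] using hint.const_smul (2 * π)⁻¹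

lemma tendsto_apply_ofReal_mul (b : SchurFunction) {z : ℂ} (hz : ‖z‖ < 1) :
    Tendsto (fun s : ℝ => b (s * z)) (𝓝[<] 1) (𝓝 (b z)) := by
  have hb : ContinuousAt b z := (b.hasDerivAt hz).continuousAt
  have hs : Continuous fun s : ℝ => (s : ℂ) * z := by fun_prop
  have hs1 : Tendsto (fun s : ℝ => (s : ℂ) * z) (𝓝[<] 1) (𝓝 z) := by
    simpa using (hs.tendsto 1).mono_left nhdsWithin_le_nhds
  exact hb.tendsto.comp hs1

lemma norm_ofReal_mul_sub_self (hs : s ≤ 1) (w : ℂ) : ‖(s : ℂ) * w - w‖ = (1 - s) * ‖w‖ := by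
  rw [← sub_one_mul, norm_mul, norm_sub_rev, ← Complex.ofReal_one, ← Complex.ofReal_sub,
    Complex.norm_of_nonneg (sub_nonneg.mpr hs)]

lemma norm_sub_div_norm {z : ℂ} (hz0 : z ≠ 0) (hz : ‖z‖ ≤ 1) : ‖z - z / ‖z‖‖ = 1 - ‖z‖ := by
  have hne : ‖z‖ ≠ 0 := norm_ne_zero_iff.mpr hz0
  have h := norm_ofReal_mul_sub_self hz (z / ‖z‖)
  rwa [mul_div_cancel₀ _ (Complex.ofReal_ne_zero.mpr hne), norm_div, Complex.norm_real, norm_norm,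
    div_self hne, mul_one] at h

lemma half_le_norm_ofReal_mul {ε : ℝ} (hb : ∀ z, ‖z‖ < 1 → ‖z - ζ‖ < ε → 1 / 2 ≤ ‖b z‖)
    (hs : s ∈ Ioo 0 1) (hsε : 1 - s < ε / 4) {w : ℂ} (hw : ‖w‖ ≤ 1) (hwζ : ‖w - ζ‖ ≤ 3 * ε / 4) :
    1 / 2 ≤ ‖b (s * w)‖ := by
  refine hb _ (mem_ball_zero_iff.mp (ofReal_mul_mem_ball hs.1.le hs.2 hw)) ?_
  have hsw : ‖(s : ℂ) * w - w‖ ≤ 1 - s := by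
    rw [norm_ofReal_mul_sub_self hs.2.le]
    exact mul_le_of_le_one_right (sub_pos.mpr hs.2).le hw
  linarith [norm_sub_le_norm_sub_add_norm_sub ((s : ℂ) * w) w ζ]

lemma neg_log_norm_ofReal_mul_le (hζ : ‖ζ‖ = 1) {ε : ℝ} (hε : ε ≤ 1) (hεo : 0 < ε)
    (hb : ∀ z, ‖z‖ < 1 → ‖z - ζ‖ < ε → 1 / 2 ≤ ‖b z‖) (hχ : 3 * ε / 4 ≤ χ.rIn)
    (hs : s ∈ Ioo 0 1) (hsε : 1 - s < ε / 4) {z : ℂ} (hz : ‖z‖ < 1) (hzζ : ‖z - ζ‖ < ε / 4) :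
    -Real.log ‖b (s * z)‖ ≤ 32 * Real.log 2 / ε ^ 2 * (1 - ‖z‖)
      + (1 + ‖z‖) / (1 - ‖z‖) * Real.circleAverage (cutoffNegLog b χ s) 0 1 := by
  have hz1 : 1 - ‖z‖ ≤ ‖z - ζ‖ := one_sub_norm_le_norm_sub hζ z
  have hz0 : z ≠ 0 := norm_pos_iff.mp (by linarith)
  set z₀ : ℂ := z / ‖z‖ with hz₀
  have hz₀1 : ‖z₀‖ = 1 := by simp [hz₀, hz0]
  have hzz₀ : ‖z - z₀‖ = 1 - ‖z‖ := norm_sub_div_norm hz0 hz.le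
  have hnear : ∀ w ∈ closedBall z₀ (ε / 4), ‖w - ζ‖ ≤ 3 * ε / 4 := fun w hw => by
    have h := norm_add₃_le (a := w - z₀) (b := z₀ - z) (c := z - ζ)
    rw [norm_sub_rev z₀ z, hzz₀, show w - z₀ + (z₀ - z) + (z - ζ) = w - ζ by ring] at h
    linarith [mem_closedBall_iff_norm.mp hw]
  have hball : ∀ w ∈ closedBall (0 : ℂ) 1, (s : ℂ) * w ∈ ball (0 : ℂ) 1 := fun w hw =>
    ofReal_mul_mem_ball hs.1.le hs.2 (mem_closedBall_zero_iff.mp hw)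
  have hhalf : ∀ w ∈ closedBall (0 : ℂ) 1 ∩ closedBall z₀ (ε / 4), 1 / 2 ≤ ‖b (s * w)‖ :=
    fun w hw =>
    half_le_norm_ofReal_mul hb hs hsε (mem_closedBall_zero_iff.mp hw.1) (hnear w hw.2)
  have hdiff : DiffContOnCl ℂ (fun w : ℂ => b (s * w)) (ball 0 1) :=
    (b.isHol.comp (by fun_prop) hball).diffContOnCl_ball subset_rfl
  refine (neg_log_norm_le_of_barrier_circleAverage (q := cutoffNegLog b χ s) hz₀1
    (by positivity : 0 < ε / 4) (Real.log_nonneg one_le_two)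
    (hdiff.mono inter_subset_left) ?_ ?_
    (continuousOn_cutoffNegLog hs) ?_ ?_ ⟨mem_ball_zero_iff.mpr hz, ?_⟩).trans_eq ?_
  · exact fun w hw => norm_pos_iff.mp (by linarith [hhalf w hw])
  · exact fun w hw => by
      simpa only [max_eq_right (hhalf w hw)] using
        (neg_log_max_half_mem_Icc (b.norm_apply_le (hball w hw.1))).2
  · exact fun w hw => (cutoffNegLog_mem_Icc hs (mem_sphere_zero_iff_norm.mp hw).le).1
  · intro w hw
    have hone : χ w = 1 := χ.one_of_mem_closedBall
      (mem_closedBall_iff_norm.mpr ((hnear w hw.2).trans hχ))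
    rw [cutoffNegLog, hone, one_mul, max_eq_right (hhalf w ⟨sphere_subset_closedBall hw.1, hw.2⟩)]
  · exact mem_ball_iff_norm.mpr (by linarith)
  · rw [hzz₀]
    ring

lemma one_sub_norm_le_of_unimodular (b : SchurFunction) (hζ : ‖ζ‖ = 1) {ε : ℝ} (hε0 : 0 < ε)
    (hε : ε ≤ 1) (hb : ∀ z, ‖z‖ < 1 → ‖z - ζ‖ < ε → 1 / 2 ≤ ‖b z‖)
    (hlim : ∀ᵐ θ : ℝ, ‖circleMap 0 1 θ - ζ‖ < ε →
      Tendsto (fun s : ℝ => ‖b (s * circleMap 0 1 θ)‖) (𝓝[<] 1) (𝓝 1))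
    {z : ℂ} (hz : ‖z‖ < 1) (hzζ : ‖z - ζ‖ < ε / 4) :
    1 - ‖b z‖ ≤ 32 * Real.log 2 / ε ^ 2 * (1 - ‖z‖) := by
  let χ : ContDiffBump ζ := ⟨3 * ε / 4, ε, by positivity, by linarith⟩
  have hbz : 0 < ‖b z‖ := by linarith [hb z hz (by linarith)]
  have hleft := ((tendsto_apply_ofReal_mul b hz).norm.log hbz.ne').neg
  have hright := ((tendsto_circleAverage_cutoffNegLog (χ := χ) hlim).const_mul
    ((1 + ‖z‖) / (1 - ‖z‖))).const_add (32 * Real.log 2 / ε ^ 2 * (1 - ‖z‖))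
  rw [mul_zero, add_zero] at hright
  have hlog : -Real.log ‖b z‖ ≤ 32 * Real.log 2 / ε ^ 2 * (1 - ‖z‖) := by
    refine le_of_tendsto_of_tendsto hleft hright ?_
    filter_upwards [Ioo_mem_nhdsLT zero_lt_one,
      Ioo_mem_nhdsLT (show 1 - ε / 4 < 1 by linarith)] with s hs hs'
    exact neg_log_norm_ofReal_mul_le hζ hε hε0 hb le_rfl hs (by linarith [hs'.1]) hz hzζ
  linarith [Real.log_le_sub_one_of_pos hbz]

end UnimodularArc

/-! ### Julia's inequality -/

lemma tendsto_ofReal_mul (ζ : ℂ) : Tendsto (fun r : ℝ => (r : ℂ) * ζ) (𝓝[<] 1) (𝓝 ζ) := by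
  have hc : Continuous fun r : ℝ => (r : ℂ) * ζ := by fun_prop
  simpa using (hc.tendsto 1).mono_left nhdsWithin_le_nhds

lemma SchurFunction.norm_one_sub_mul_sq_le_of_tendsto (b : SchurFunction) {ζ β : ℂ} {M : ℝ}
    {ι : Type*} {l : Filter ι} [l.NeBot] {x : ι → ℂ} (hx1 : ∀ᶠ i in l, ‖x i‖ < 1)
    (hx : Tendsto x l (𝓝 ζ)) (hβ : Tendsto (fun i => conj (b (x i))) l (𝓝 β))
    (hM : ∀ᶠ i in l, 1 - ‖b (x i)‖ ^ 2 ≤ M * (1 - ‖x i‖ ^ 2)) {z : ℂ} (hz : ‖z‖ < 1) :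
    ‖1 - β * b z‖ ^ 2 * (1 - ‖z‖ ^ 2) ≤ (1 - ‖b z‖ ^ 2) * M * ‖1 - conj ζ * z‖ ^ 2 := by
  have hleft := ((((hβ.mul_const (b z)).const_sub 1).norm.pow 2).mul_const (1 - ‖z‖ ^ 2))
  have hconj : Tendsto (fun i => conj (x i)) l (𝓝 (conj ζ)) :=
    (Complex.continuous_conj.tendsto ζ).comp hx
  have hright := (((hconj.mul_const z).const_sub 1).norm.pow 2).const_mul ((1 - ‖b z‖ ^ 2) * M)
  refine le_of_tendsto_of_tendsto hleft hright ?_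
  filter_upwards [hx1, hM] with i hi hMi
  have hnonneg : 0 ≤ (1 - ‖b z‖ ^ 2) * ‖1 - conj (x i) * z‖ ^ 2 :=
    mul_nonneg (b.one_sub_norm_sq_nonneg hz) (sq_nonneg _)
  refine le_of_mul_le_mul_right ?_ (one_sub_norm_sq_pos hi)
  calc ‖1 - conj (b (x i)) * b z‖ ^ 2 * (1 - ‖z‖ ^ 2) * (1 - ‖x i‖ ^ 2)
      ≤ (1 - ‖b z‖ ^ 2) * ‖1 - conj (x i) * z‖ ^ 2 * (1 - ‖b (x i)‖ ^ 2) := by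
        linarith [norm_one_sub_conj_mul_sq_le b hz hi]
    _ ≤ (1 - ‖b z‖ ^ 2) * ‖1 - conj (x i) * z‖ ^ 2 * (M * (1 - ‖x i‖ ^ 2)) :=
        mul_le_mul_of_nonneg_left hMi hnonneg
    _ = _ := by ring

section Julia

variable {b : SchurFunction} {ζ : ℂ} {η A : ℝ}

lemma one_sub_norm_le_one_sub_norm_sq {z : ℂ} (hz : ‖z‖ ≤ 1) : 1 - ‖z‖ ≤ 1 - ‖z‖ ^ 2 :=
  sub_le_sub_left (pow_le_of_le_one (norm_nonneg z) hz two_ne_zero) 1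

lemma SchurFunction.one_sub_norm_sq_le (b : SchurFunction) {z : ℂ} (hz : ‖z‖ < 1) {t : ℝ}
    (ht : 1 - ‖b z‖ ≤ t) : 1 - ‖b z‖ ^ 2 ≤ 2 * t := by
  nlinarith [b.norm_apply_le' hz, norm_nonneg (b z)]

/-- Julia's inequality at a boundary point of finite angular derivative. -/
lemma SchurFunction.exists_norm_one_sub_mul_sq_le (b : SchurFunction) (hζ : ‖ζ‖ = 1) (hη : 0 < η)
    (hA0 : 0 ≤ A) (hA : ∀ z, ‖z‖ < 1 → ‖z - ζ‖ < η → 1 - ‖b z‖ ≤ A * (1 - ‖z‖)) :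
    ∃ β : ℂ, ‖β‖ = 1 ∧ ∀ z, ‖z‖ < 1 →
      ‖1 - β * b z‖ ^ 2 * (1 - ‖z‖ ^ 2) ≤ (1 - ‖b z‖ ^ 2) * (2 * A) * ‖z - ζ‖ ^ 2 := by
  let l : Ultrafilter ℝ := .of (𝓝[<] 1)
  have hl : (l : Filter ℝ) ≤ 𝓝[<] 1 := Ultrafilter.of_le _
  have hlim : Tendsto (fun r : ℝ => (r : ℂ) * ζ) l (𝓝 ζ) := (tendsto_ofReal_mul ζ).mono_left hl
  have hlt : ∀ᶠ r : ℝ in l, ‖(r : ℂ) * ζ‖ < 1 := hl <| by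
    filter_upwards [Ioo_mem_nhdsLT zero_lt_one] with r hr
    exact mem_ball_zero_iff.mp (ofReal_mul_mem_ball hr.1.le hr.2 hζ.le)
  have hbound : ∀ᶠ r : ℝ in l, 1 - ‖b (r * ζ)‖ ≤ A * (1 - ‖(r : ℂ) * ζ‖) := by
    filter_upwards [hlt, hlim.eventually (ball_mem_nhds ζ hη)] with r hr hrη
    exact hA _ hr (mem_ball_iff_norm.mp hrη)
  have hcpt : ∀ᶠ r : ℝ in l, conj (b (r * ζ)) ∈ closedBall (0 : ℂ) 1 := by
    filter_upwards [hlt] with r hr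
    simpa using b.norm_apply_le' hr
  obtain ⟨β, -, hβ : Tendsto (fun r : ℝ => conj (b (r * ζ))) l (𝓝 β)⟩ :=
    (isCompact_closedBall (0 : ℂ) 1).ultrafilter_le_nhds (l.map _) (le_principal_iff.mpr hcpt)
  refine ⟨β, ?_, fun z hz => ?_⟩
  · have hlow : Tendsto (fun r : ℝ => 1 - A * (1 - ‖(r : ℂ) * ζ‖)) l (𝓝 1) := by
      simpa [hζ] using ((hlim.norm.const_sub 1).const_mul A).const_sub 1
    refine tendsto_nhds_unique hβ.norm
      (tendsto_of_tendsto_of_tendsto_of_le_of_le' hlow tendsto_const_nhds ?_ ?_)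
    · filter_upwards [hbound] with r hr
      rw [RCLike.norm_conj]
      linarith
    · filter_upwards [hlt] with r hr
      rw [RCLike.norm_conj]
      exact b.norm_apply_le' hr
  · rw [← norm_one_sub_conj_mul hζ]
    refine b.norm_one_sub_mul_sq_le_of_tendsto hlt hlim hβ ?_ hz
    filter_upwards [hlt, hbound] with r hr hrA
    have hle := mul_le_mul_of_nonneg_left (one_sub_norm_le_one_sub_norm_sq hr.le) hA0
    linarith [b.one_sub_norm_sq_le hr hrA]

lemma exists_re_one_sub_le (b : SchurFunction) (hζ : ‖ζ‖ = 1) (hη : 0 < η) (hA0 : 0 ≤ A)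
    (hA : ∀ z, ‖z‖ < 1 → ‖z - ζ‖ < η → 1 - ‖b z‖ ≤ A * (1 - ‖z‖)) :
    ∃ (β : ℂ) (C : ℝ), ‖β‖ = 1 ∧ 0 ≤ C ∧
      ∀ z, ‖z‖ < 1 → (1 - β * b z).re ≤ C * (‖z - ζ‖ ^ 2 + (1 - ‖z‖)) := by
  obtain ⟨β, hβ, hjulia⟩ := b.exists_norm_one_sub_mul_sq_le hζ hη hA0 hA
  refine ⟨β, 2 * A ^ 2 + A + 2 / η ^ 2, hβ, by positivity, fun z hz => ?_⟩
  have : 0 < 1 - ‖z‖ := sub_pos.mpr hz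
  rcases lt_or_ge ‖z - ζ‖ η with hzη | hzη
  · have hsq : 1 - ‖b z‖ ^ 2 ≤ 2 * (A * (1 - ‖z‖)) := b.one_sub_norm_sq_le hz (hA z hz hzη)
    have hnum : ‖1 - β * b z‖ ^ 2 ≤ 4 * A ^ 2 * ‖z - ζ‖ ^ 2 := by
      refine le_of_mul_le_mul_right ((hjulia z hz).trans ?_) (one_sub_norm_sq_pos hz)
      calc (1 - ‖b z‖ ^ 2) * (2 * A) * ‖z - ζ‖ ^ 2
          ≤ 2 * (A * (1 - ‖z‖ ^ 2)) * (2 * A) * ‖z - ζ‖ ^ 2 := by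
            gcongr
            linarith [mul_le_mul_of_nonneg_left (one_sub_norm_le_one_sub_norm_sq hz.le) hA0]
        _ = _ := by ring
    have hre := two_mul_re_one_sub (β * b z)
    rw [norm_mul, hβ, one_mul] at hre
    have h₁ : 0 ≤ 2 / η ^ 2 * (‖z - ζ‖ ^ 2 + (1 - ‖z‖)) := by positivity
    have h₂ : 0 ≤ A ^ 2 * (1 - ‖z‖) := by positivity
    have h₃ : 0 ≤ A * ‖z - ζ‖ ^ 2 := by positivity
    linarith
  · have hre : (1 - β * b z).re ≤ 2 := by
      refine (Complex.re_le_norm _).trans ((norm_sub_le _ _).trans ?_)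
      rw [norm_mul, hβ, norm_one]
      linarith [b.norm_apply_le' hz]
    have hfar : 2 ≤ 2 / η ^ 2 * ‖z - ζ‖ ^ 2 := by
      rw [div_mul_eq_mul_div, le_div_iff₀ (by positivity)]
      gcongr
    have h₁ : 0 ≤ (2 * A ^ 2 + A) * (‖z - ζ‖ ^ 2 + (1 - ‖z‖)) := by positivity
    have h₂ : 0 ≤ 2 / η ^ 2 * (1 - ‖z‖) := by positivity
    linarith

end Julia

/-! ### Comparing the quadratic forms of `k^b` and of `(z - ζ) H²` -/

/-- The quadratic form of the kernel `k^b` at a finite combination of point evaluations. -/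
def dbrForm (b : ℂ → ℂ) (s : Finset Complex.UnitDisc) (c : Complex.UnitDisc → ℂ) : ℝ :=
  (∑ x ∈ s, ∑ y ∈ s, dbrKernel b y x * c x * conj (c y)).re

section QuadraticForm

variable (s : Finset Complex.UnitDisc) (c : Complex.UnitDisc → ℂ)

lemma continuousOn_szegoSum : ContinuousOn (szegoSum s c) (sphere 0 1) :=
  continuousOn_sphere_of_diffContOnCl (diffContOnCl_szegoSum s c)

lemma circleAverage_norm_sq_szegoSum :
    ((Real.circleAverage (fun z => ‖szegoSum s c z‖ ^ 2) 0 1 : ℝ) : ℂ)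
      = ∑ x ∈ s, conj (c x) * szegoSum s c x := by
  rw [← circleAverage_mul_conj (diffContOnCl_szegoSum s c)]
  simp only [Complex.mul_conj', ← Complex.ofReal_pow]
  exact (Complex.ofRealCLM.circleAverage_comp_comm
    ((continuousOn_szegoSum s c).norm.pow 2 |>.circleIntegrable zero_le_one)).symm

lemma sum_mul_szegoSum (d : Complex.UnitDisc → ℂ) :
    ∑ y ∈ s, d y * szegoSum s c y = ∑ x ∈ s, ∑ y ∈ s, d y * c x / (1 - conj (x : ℂ) * y) := by
  rw [Finset.sum_comm]
  simp only [szegoSum, Finset.mul_sum, mul_div_assoc]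

lemma conj_sum_mul_szegoSum (d : Complex.UnitDisc → ℂ) :
    conj (∑ y ∈ s, d y * szegoSum s c y)
      = ∑ x ∈ s, ∑ y ∈ s, conj (d x) * conj (c y) / (1 - conj (x : ℂ) * y) := by
  rw [sum_mul_szegoSum, Finset.sum_comm]
  simp only [map_sum]
  refine Finset.sum_congr rfl fun x _ => Finset.sum_congr rfl fun y _ => ?_
  simp only [map_div₀, map_mul, map_sub, map_one, Complex.conj_conj]
  rw [mul_comm (y : ℂ) (conj (x : ℂ))]

/-- With `φ = 1 - β b` one has `1 - conj b(x) b(y) = φ(y) + conj φ(x) - φ(y) conj φ(x)`, and the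
last term contributes a nonpositive quantity. -/
lemma dbrForm_le_re_sum (b : ℂ → ℂ) {β : ℂ} (hβ : ‖β‖ = 1) :
    dbrForm b s c ≤ 2 * (∑ y ∈ s, conj (c y) * (1 - β * b y) * szegoSum s c y).re := by
  set φ : ℂ → ℂ := fun z => 1 - β * b z
  set T := ∑ y ∈ s, conj (c y) * φ y * szegoSum s c y with hT
  set d : Complex.UnitDisc → ℂ := fun x => c x * conj (φ x)
  have hββ : β * conj β = 1 := by simp [Complex.mul_conj', hβ]
  have hφ : ∀ x y, 1 - conj (b x) * b y = φ y + conj (φ x) - φ y * conj (φ x) := fun x y => by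
    simp only [φ, map_sub, map_one, map_mul]
    linear_combination (b y * conj (b x)) * hββ
  have hform : ∑ x ∈ s, ∑ y ∈ s, dbrKernel b y x * c x * conj (c y)
      = T + conj T - ∑ x ∈ s, conj (d x) * szegoSum s d x := by
    rw [hT, conj_sum_mul_szegoSum, sum_mul_szegoSum, sum_mul_szegoSum]
    simp only [← Finset.sum_add_distrib, ← Finset.sum_sub_distrib]
    refine Finset.sum_congr rfl fun x _ => Finset.sum_congr rfl fun y _ => ?_
    simp only [dbrKernel, hφ, d, map_mul, Complex.conj_conj]
    ring
  have hnonneg : 0 ≤ Real.circleAverage (fun z => ‖szegoSum s d z‖ ^ 2) 0 1 :=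
    Real.circleAverage_nonneg_of_nonneg fun z _ => sq_nonneg _
  rw [dbrForm, hform, ← circleAverage_norm_sq_szegoSum, Complex.sub_re, Complex.ofReal_re,
    Complex.add_re, Complex.conj_re]
  linarith

lemma re_sum_mul_szegoSum_le {φ : ℂ → ℂ} (hφ : DiffContOnCl ℂ φ (ball 0 1)) {q : ℂ → ℝ}
    (hq : ContinuousOn q (sphere 0 1)) (hle : ∀ z ∈ sphere (0 : ℂ) 1, (φ z).re ≤ q z) :
    (∑ y ∈ s, conj (c y) * φ y * szegoSum s c y).re
      ≤ Real.circleAverage (fun z => q z * ‖szegoSum s c z‖ ^ 2) 0 1 := by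
  have hF := continuousOn_szegoSum s c
  have hint := circleIntegrable_mul_conj (hφ.smul (diffContOnCl_szegoSum s c)) s c
  have hre : ∀ z, (φ z • szegoSum s c z * conj (szegoSum s c z)).re
      = (φ z).re * ‖szegoSum s c z‖ ^ 2 := fun z => by
    rw [smul_eq_mul, mul_assoc, Complex.mul_conj', ← Complex.ofReal_pow, Complex.re_mul_ofReal]
  simp only [mul_assoc, ← smul_eq_mul (φ _)]
  rw [← circleAverage_mul_conj (hφ.smul (diffContOnCl_szegoSum s c)), ← circleAverage_re hint]
  simp only [hre]
  refine Real.circleAverage_mono (ContinuousOn.circleIntegrable zero_le_one ?_)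
    ((hq.mul (hF.norm.pow 2)).circleIntegrable zero_le_one) fun z hz => ?_
  · exact (Complex.continuous_re.comp_continuousOn
      (continuousOn_sphere_of_diffContOnCl hφ)).mul (hF.norm.pow 2)
  · rw [abs_one] at hz
    gcongr
    exact hle z hz

lemma norm_ofReal_mul_sub_sq_le {r : ℝ} (hr : r ∈ Ioo 0 1) {z ζ : ℂ} (hz : ‖z‖ = 1)
    (hζ : ‖ζ‖ = 1) : ‖(r : ℂ) * z - ζ‖ ^ 2 ≤ ‖z - ζ‖ ^ 2 + (1 - r) := by
  have hexp : ‖(r : ℂ) * z - ζ‖ ^ 2 = (1 - r) ^ 2 + r * ‖z - ζ‖ ^ 2 := by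
    have hz2 : Complex.normSq z = 1 := by rw [Complex.normSq_eq_norm_sq, hz, one_pow]
    have hζ2 : Complex.normSq ζ = 1 := by rw [Complex.normSq_eq_norm_sq, hζ, one_pow]
    simp only [← Complex.normSq_eq_norm_sq, Complex.normSq_sub, map_mul, Complex.normSq_ofReal,
      mul_assoc, Complex.re_ofReal_mul, hz2, hζ2]
    ring
  nlinarith [hr.1, hr.2, sq_nonneg ‖z - ζ‖]

lemma circleAverage_norm_sq_add_mul {F : ℂ → ℂ} (hF : ContinuousOn F (sphere 0 1)) (ζ : ℂ)
    (C ε : ℝ) :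
    Real.circleAverage (fun z => C * (‖z - ζ‖ ^ 2 + ε) * ‖F z‖ ^ 2) 0 1
      = C * (Real.circleAverage (fun z => ‖(z - ζ) * F z‖ ^ 2) 0 1
        + ε * Real.circleAverage (fun z => ‖F z‖ ^ 2) 0 1) := by
  have h₁ : CircleIntegrable (fun z => ‖(z - ζ) * F z‖ ^ 2) 0 1 :=
    ContinuousOn.circleIntegrable zero_le_one (by fun_prop)
  have h₂ : CircleIntegrable (fun z => ε • ‖F z‖ ^ 2) 0 1 :=
    ContinuousOn.circleIntegrable zero_le_one (by fun_prop)
  rw [← smul_eq_mul ε, ← Real.circleAverage_fun_smul, ← Real.circleAverage_fun_add h₁ h₂,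
    ← smul_eq_mul C, ← Real.circleAverage_fun_smul]
  congr 1 with z
  rw [norm_mul, mul_pow, smul_eq_mul, smul_eq_mul]
  ring

lemma dbrForm_le_circleAverage (b : SchurFunction) {ζ β : ℂ} {C : ℝ} (hζ : ‖ζ‖ = 1) (hβ : ‖β‖ = 1)
    (hC : 0 ≤ C) (h : ∀ z, ‖z‖ < 1 → (1 - β * b z).re ≤ C * (‖z - ζ‖ ^ 2 + (1 - ‖z‖))) :
    dbrForm b s c
      ≤ 2 * C * Real.circleAverage (fun z => ‖(z - ζ) * szegoSum s c z‖ ^ 2) 0 1 := by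
  refine (dbrForm_le_re_sum s c b hβ).trans ?_
  rw [mul_assoc]
  refine mul_le_mul_of_nonneg_left ?_ two_pos.le
  set F := szegoSum s c
  set I := Real.circleAverage (fun z => ‖(z - ζ) * F z‖ ^ 2) 0 1
  set J := Real.circleAverage (fun z => ‖F z‖ ^ 2) 0 1
  have hF : ContinuousOn F (sphere 0 1) := continuousOn_szegoSum s c
  have hleft : Tendsto (fun r : ℝ => (∑ y ∈ s, conj (c y) * (1 - β * b (r * y)) * F y).re) (𝓝[<] 1)
      (𝓝 (∑ y ∈ s, conj (c y) * (1 - β * b y) * F y).re) :=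
    (Complex.continuous_re.tendsto _).comp <| tendsto_finsetSum _ fun y _ =>
      (((tendsto_apply_ofReal_mul b y.norm_lt_one).const_mul β).const_sub 1 |>.const_mul
        (conj (c y))).mul_const (F y)
  have hright : Tendsto (fun r : ℝ => C * (I + 2 * (1 - r) * J)) (𝓝[<] 1) (𝓝 (C * I)) := by
    have hc : Continuous fun r : ℝ => C * (I + 2 * (1 - r) * J) := by fun_prop
    simpa using (hc.tendsto 1).mono_left nhdsWithin_le_nhds
  refine le_of_tendsto_of_tendsto hleft hright ?_
  filter_upwards [Ioo_mem_nhdsLT zero_lt_one] with r hr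
  have hφ : DiffContOnCl ℂ (fun z => 1 - β * b (r * z)) (ball 0 1) := by
    have hbr : DifferentiableOn ℂ (fun z : ℂ => b (r * z)) (closedBall 0 1) :=
      b.isHol.comp (by fun_prop) fun z hz =>
        ofReal_mul_mem_ball hr.1.le hr.2 (mem_closedBall_zero_iff.mp hz)
    exact ((hbr.const_mul β).const_sub 1).diffContOnCl_ball subset_rfl
  refine (re_sum_mul_szegoSum_le s c hφ (q := fun z => C * (‖z - ζ‖ ^ 2 + 2 * (1 - r)))
    (by fun_prop) fun z hz => ?_).trans_eq ?_
  · have hz1 : ‖z‖ = 1 := mem_sphere_zero_iff_norm.mp hz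
    have hrz : ‖(r : ℂ) * z‖ = r := by rw [norm_mul, hz1, mul_one, Complex.norm_of_nonneg hr.1.le]
    refine (h _ (hrz.trans_lt hr.2)).trans (mul_le_mul_of_nonneg_left ?_ hC)
    linarith [norm_ofReal_mul_sub_sq_le hr hz1 hζ]
  · exact circleAverage_norm_sq_add_mul hF ζ C (2 * (1 - r))

end QuadraticForm

/-! ### Riesz representation along a linear map -/

lemma exists_inner_eq_of_norm_le {M E : Type*} [AddCommGroup M] [Module ℂ M]
    [NormedAddCommGroup E] [InnerProductSpace ℂ E] [CompleteSpace E] (V : M →ₗ[ℂ] E)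
    (l : M →ₗ[ℂ] ℂ) {K : ℝ} (hK : 0 ≤ K) (h : ∀ m, ‖l m‖ ≤ K * ‖V m‖) :
    ∃ g : E, ‖g‖ ≤ K ∧ ∀ m, l m = inner ℂ g (V m) := by
  obtain ⟨σ, hσ⟩ := V.rangeRestrict.exists_rightInverse_of_surjective V.range_rangeRestrict
  have hVσ : ∀ y : LinearMap.range V, V (σ y) = y := fun y =>
    congrArg Subtype.val (LinearMap.congr_fun hσ y)
  let l₀ : StrongDual ℂ (LinearMap.range V) := (l.comp σ).mkContinuous K fun y => by
    have hy := h (σ y)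
    rwa [hVσ] at hy
  obtain ⟨L, hL, hLnorm⟩ := exists_extension_norm_eq (LinearMap.range V) l₀
  refine ⟨(InnerProductSpace.toDual ℂ E).symm L, ?_, fun m => ?_⟩
  · rw [LinearIsometryEquiv.norm_map, hLnorm]
    exact LinearMap.mkContinuous_norm_le _ hK _
  · set m' := σ ⟨V m, LinearMap.mem_range_self V m⟩
    have hzero : ‖l (m - m')‖ ≤ 0 := by simpa [m', hVσ] using h (m - m')
    rw [InnerProductSpace.toDual_symm_apply, hL ⟨V m, LinearMap.mem_range_self V m⟩]
    exact sub_eq_zero.mp ((map_sub l m m').symm.trans (norm_le_zero_iff.mp hzero))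

/-! ### Square-summable coefficients for the shifted Szegő kernels -/

/-- The Taylor coefficients of the shifted Szegő kernel `(z - ζ) / (1 - conj x * z)`. -/
def shiftedSzegoCoeff (ζ : ℂ) (x : Complex.UnitDisc) : ℕ → ℂ
  | 0 => -ζ
  | n + 1 => conj (x : ℂ) ^ n - ζ * conj (x : ℂ) ^ (n + 1)

lemma norm_conj_mul_lt_one (x : Complex.UnitDisc) {z : ℂ} (hz : ‖z‖ ≤ 1) :
    ‖conj (x : ℂ) * z‖ < 1 := by
  rw [norm_mul, RCLike.norm_conj]
  exact (mul_le_of_le_one_right (norm_nonneg _) hz).trans_lt x.norm_lt_one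

lemma hasSum_shiftedSzegoCoeff (ζ : ℂ) (x : Complex.UnitDisc) {z : ℂ} (hz : ‖z‖ ≤ 1) :
    HasSum (fun n => shiftedSzegoCoeff ζ x n * z ^ n) ((z - ζ) / (1 - conj (x : ℂ) * z)) := by
  have hne : 1 - conj (x : ℂ) * z ≠ 0 := one_sub_conj_mul_ne_zero x.norm_lt_one hz
  have hgeom : HasSum (fun n => (conj (x : ℂ) * z) ^ n) (1 - conj (x : ℂ) * z)⁻¹ :=
    hasSum_geometric_of_norm_lt_one (norm_conj_mul_lt_one x hz)
  rw [← hasSum_nat_add_iff' 1]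
  have hval : (z - ζ) / (1 - conj (x : ℂ) * z)
        - ∑ n ∈ Finset.range 1, shiftedSzegoCoeff ζ x n * z ^ n
      = (1 - ζ * conj (x : ℂ)) * z * (1 - conj (x : ℂ) * z)⁻¹ := by
    rw [Finset.sum_range_one, shiftedSzegoCoeff]
    linear_combination (-ζ) * mul_inv_cancel₀ hne
  rw [hval]
  refine (hgeom.mul_left _).congr_fun fun n => ?_
  rw [shiftedSzegoCoeff]
  ring

lemma summable_norm_shiftedSzegoCoeff (ζ : ℂ) (x : Complex.UnitDisc) :
    Summable fun n => ‖shiftedSzegoCoeff ζ x n‖ := by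
  simpa using (hasSum_shiftedSzegoCoeff ζ x (z := 1) (by simp)).summable.norm

lemma memℓp_shiftedSzegoCoeff (ζ : ℂ) (x : Complex.UnitDisc) :
    Memℓp (shiftedSzegoCoeff ζ x) 2 := by
  have h1 : Memℓp (shiftedSzegoCoeff ζ x) 1 := by
    rw [memℓp_gen_iff (by norm_num)]
    simpa using summable_norm_shiftedSzegoCoeff ζ x
  exact h1.of_exponent_ge (by norm_num)

/-- The shifted Szegő kernel `(z - ζ) / (1 - conj x * z)`, as an element of `ℓ²`, that is, of
`H²` through its Taylor coefficients. -/
def shiftedSzego (ζ : ℂ) (x : Complex.UnitDisc) : lp (fun _ : ℕ => ℂ) 2 :=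
  ⟨shiftedSzegoCoeff ζ x, memℓp_shiftedSzegoCoeff ζ x⟩

lemma hasSum_norm_sq_lp (g : lp (fun _ : ℕ => ℂ) 2) :
    HasSum (fun n => ‖g n‖ ^ 2) (‖g‖ ^ 2) := by
  simpa using lp.hasSum_norm (p := 2) (by norm_num) g

lemma linearCombination_shiftedSzego_apply (ζ : ℂ) (c : Complex.UnitDisc →₀ ℂ) (n : ℕ) :
    Finsupp.linearCombination ℂ (shiftedSzego ζ) c n
      = ∑ x ∈ c.support, c x * shiftedSzegoCoeff ζ x n := by
  rw [Finsupp.linearCombination_apply, Finsupp.sum, lp.coeFn_sum, Finset.sum_apply]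
  rfl

lemma norm_sq_linearCombination_shiftedSzego (ζ : ℂ) (c : Complex.UnitDisc →₀ ℂ) :
    ‖Finsupp.linearCombination ℂ (shiftedSzego ζ) c‖ ^ 2
      = Real.circleAverage (fun z => ‖(z - ζ) * szegoSum c.support c z‖ ^ 2) 0 1 := by
  have hsummable : Summable fun n => ‖Finsupp.linearCombination ℂ (shiftedSzego ζ) c n‖ := by
    have h : Summable fun n => ∑ x ∈ c.support, ‖c x * shiftedSzegoCoeff ζ x n‖ :=
      summable_sum fun x _ => by
        simpa only [norm_mul] using (summable_norm_shiftedSzegoCoeff ζ x).mul_left ‖c x‖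
    refine h.of_nonneg_of_le (fun _ => norm_nonneg _) fun n => ?_
    rw [linearCombination_shiftedSzego_apply]
    exact norm_sum_le _ _
  refine (hasSum_norm_sq_lp _).unique (hasSum_norm_sq_circleAverage hsummable fun z hz => ?_)
  have hz1 : ‖z‖ ≤ 1 := (mem_sphere_zero_iff_norm.mp hz).le
  have hsum : HasSum (fun n => ∑ x ∈ c.support, c x * (shiftedSzegoCoeff ζ x n * z ^ n))
      (∑ x ∈ c.support, c x * ((z - ζ) / (1 - conj (x : ℂ) * z))) :=
    hasSum_sum fun x _ => (hasSum_shiftedSzegoCoeff ζ x hz1).mul_left _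
  have hval : (z - ζ) * szegoSum c.support c z
      = ∑ x ∈ c.support, c x * ((z - ζ) / (1 - conj (x : ℂ) * z)) := by
    rw [szegoSum, Finset.mul_sum]
    exact Finset.sum_congr rfl fun x _ => by ring
  rw [hval]
  refine hsum.congr_fun fun n => ?_
  rw [linearCombination_shiftedSzego_apply, Finset.sum_mul]
  exact Finset.sum_congr rfl fun x _ => by ring

lemma hasSum_inner_shiftedSzego (ζ : ℂ) (x : Complex.UnitDisc) (g : lp (fun _ : ℕ => ℂ) 2) :
    HasSum (fun n => (g (n + 1) - conj ζ * g n) * (x : ℂ) ^ n)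
      (inner ℂ (shiftedSzego ζ x) g) := by
  obtain ⟨G, hG⟩ : Summable fun n => g n * (x : ℂ) ^ n := by
    refine Summable.of_norm_bounded
      ((summable_geometric_of_lt_one (norm_nonneg _) x.norm_lt_one).mul_left ‖g‖) fun n => ?_
    rw [norm_mul, norm_pow]
    gcongr
    exact lp.norm_apply_le_norm (by norm_num) g n
  have hinner : HasSum (fun n => conj (shiftedSzegoCoeff ζ x n) * g n)
      (inner ℂ (shiftedSzego ζ x) g) :=
    (lp.hasSum_inner (𝕜 := ℂ) (shiftedSzego ζ x) g).congr_fun fun n => mul_comm _ _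
  have htail := ((hasSum_nat_add_iff' 1).mpr hinner).add
    (((hasSum_nat_add_iff' 1).mpr hG).mul_left (conj ζ))
  have hval : inner ℂ (shiftedSzego ζ x) g = inner ℂ (shiftedSzego ζ x) g
      - ∑ n ∈ Finset.range 1, conj (shiftedSzegoCoeff ζ x n) * g n
      + conj ζ * (G - ∑ n ∈ Finset.range 1, g n * (x : ℂ) ^ n) - conj ζ * G := by
    rw [Finset.sum_range_one, Finset.sum_range_one, shiftedSzegoCoeff, map_neg]
    ring
  rw [hval]
  refine (htail.sub (hG.mul_left (conj ζ))).congr_fun fun n => ?_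
  rw [shiftedSzegoCoeff, map_sub, map_mul, map_pow, map_pow, Complex.conj_conj]
  ring

/-! ### Membership in `𝒟_ζ` from a bound by the shifted Szegő form -/

/-- The bound makes `(z - ζ) k_x ↦ conj (f x)` a bounded functional on a subspace of `H²`; the `g`
representing it satisfies `f x = ⟪(z - ζ) k_x, g⟫`. -/
lemma exists_lp_hasSum_of_norm_sum_sq_le {ζ : ℂ} {f : ℂ → ℂ} {K : ℝ} (hK : 0 ≤ K)
    (hf : ∀ (s : Finset Complex.UnitDisc) (c : Complex.UnitDisc → ℂ),
      ‖∑ x ∈ s, conj (c x) * f x‖ ^ 2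
        ≤ K * Real.circleAverage (fun z => ‖(z - ζ) * szegoSum s c z‖ ^ 2) 0 1) :
    ∃ g : lp (fun _ : ℕ => ℂ) 2, ‖g‖ ^ 2 ≤ K ∧
      ∀ z ∈ ball (0 : ℂ) 1, HasSum (fun n => (g (n + 1) - conj ζ * g n) * z ^ n) (f z) := by
  set l : (Complex.UnitDisc →₀ ℂ) →ₗ[ℂ] ℂ :=
    Finsupp.linearCombination ℂ (fun x : Complex.UnitDisc => conj (f x)) with hl
  have hbound : ∀ c, ‖l c‖ ≤ √K * ‖Finsupp.linearCombination ℂ (shiftedSzego ζ) c‖ := by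
    intro c
    have hlc : ‖l c‖ = ‖∑ x ∈ c.support, conj (c x) * f x‖ := by
      rw [← RCLike.norm_conj, hl, Finsupp.linearCombination_apply, Finsupp.sum, map_sum]
      simp only [smul_eq_mul, map_mul, Complex.conj_conj]
    refine le_of_sq_le_sq ?_ (by positivity)
    rw [mul_pow, Real.sq_sqrt hK, hlc, norm_sq_linearCombination_shiftedSzego]
    exact hf c.support c
  obtain ⟨g, hg, hgl⟩ := exists_inner_eq_of_norm_le _ l (Real.sqrt_nonneg K) hbound
  refine ⟨g, (Real.le_sqrt (norm_nonneg g) hK).mp hg, fun z hz => ?_⟩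
  set x : Complex.UnitDisc := Complex.UnitDisc.mk z (mem_ball_zero_iff.mp hz)
  have hgx : conj (f x) = inner ℂ g (shiftedSzego ζ x) := by
    simpa [hl] using hgl (Finsupp.single x 1)
  have hfx : f x = inner ℂ (shiftedSzego ζ x) g := by
    rw [← inner_conj_symm, ← hgx, Complex.conj_conj]
  exact hfx ▸ hasSum_inner_shiftedSzego ζ x g

lemma tsum_norm_sq_succ_le (g : lp (fun _ : ℕ => ℂ) 2) : ∑' n, ‖g (n + 1)‖ ^ 2 ≤ ‖g‖ ^ 2 := by
  have h := (hasSum_norm_sq_lp g).summable.sum_add_tsum_nat_add 1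
  rw [(hasSum_norm_sq_lp g).tsum_eq, Finset.sum_range_one] at h
  linarith [sq_nonneg ‖g 0‖]

section ShiftedCoefficients

variable {ζ : ℂ} {f : ℂ → ℂ} {g : lp (fun _ : ℕ => ℂ) 2}

lemma dirichletIntegral_le_of_taylorCoeff_eq (hζ : ‖ζ‖ = 1) (hf : IsHol f)
    (hfg : ∀ n, taylorCoeff f n = g (n + 1) - conj ζ * g n) :
    dirichletIntegral ζ f ≤ ENNReal.ofReal (‖g‖ ^ 2) := by
  have hnorm : ∀ n, ‖-conj ζ * g (n + 1)‖ ^ 2 = ‖g (n + 1)‖ ^ 2 := fun n => by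
    rw [norm_mul, norm_neg, RCLike.norm_conj, hζ, one_mul]
  have hsummable : Summable fun n => ‖g (n + 1)‖ ^ 2 :=
    (summable_nat_add_iff 1).mpr (hasSum_norm_sq_lp g).summable
  have hζζ : ζ * conj ζ = 1 := by rw [Complex.mul_conj', hζ]; simp
  have hcoeff : ∀ n, taylorCoeff f (n + 1)
      = -conj ζ * g (n + 1) - ζ * (-conj ζ * g (n + 1 + 1)) := fun n => by
    rw [hfg]
    linear_combination (-g (n + 1 + 1)) * hζζ
  have hD := dirichletIntegral_le_tsum hζ hf (g := fun n => -conj ζ * g (n + 1))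
    (by simpa only [hnorm] using hsummable) hcoeff
  simp only [hnorm] at hD
  exact hD.trans (ENNReal.ofReal_le_ofReal (tsum_norm_sq_succ_le g))

lemma hardyNormSq_le_of_taylorCoeff_eq (hζ : ‖ζ‖ = 1)
    (hfg : ∀ n, taylorCoeff f n = g (n + 1) - conj ζ * g n) :
    hardyNormSq f ≤ ENNReal.ofReal (4 * ‖g‖ ^ 2) := by
  have hg := hasSum_norm_sq_lp g
  have hg1 : Summable fun n => ‖g (n + 1)‖ ^ 2 := (summable_nat_add_iff 1).mpr hg.summable
  have hterm : ∀ n, ‖taylorCoeff f n‖ₑ ^ 2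
      ≤ ENNReal.ofReal (2 * ‖g (n + 1)‖ ^ 2 + 2 * ‖g n‖ ^ 2) := fun n => by
    rw [enorm_sq_eq_ofReal, hfg]
    refine ENNReal.ofReal_le_ofReal ?_
    have htri : ‖g (n + 1) - conj ζ * g n‖ ≤ ‖g (n + 1)‖ + ‖g n‖ := by
      refine (norm_sub_le _ _).trans_eq ?_
      rw [norm_mul, RCLike.norm_conj, hζ, one_mul]
    nlinarith [pow_le_pow_left₀ (norm_nonneg _) htri 2, sq_nonneg (‖g (n + 1)‖ - ‖g n‖)]
  refine (ENNReal.tsum_le_tsum hterm).trans ?_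
  rw [← ENNReal.ofReal_tsum_of_nonneg (fun n => by positivity)
    ((hg1.mul_left 2).add (hg.summable.mul_left 2))]
  refine ENNReal.ofReal_le_ofReal ?_
  rw [(hg1.mul_left 2).tsum_add (hg.summable.mul_left 2), tsum_mul_left, tsum_mul_left, hg.tsum_eq]
  linarith [tsum_norm_sq_succ_le g]

end ShiftedCoefficients

lemma mem_dirichletSpace_of_norm_sum_sq_le {ζ : ℂ} (hζ : ‖ζ‖ = 1) {f : ℂ → ℂ} {K : ℝ} (hK : 0 ≤ K)
    (hf : ∀ (s : Finset Complex.UnitDisc) (c : Complex.UnitDisc → ℂ),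
      ‖∑ x ∈ s, conj (c x) * f x‖ ^ 2
        ≤ K * Real.circleAverage (fun z => ‖(z - ζ) * szegoSum s c z‖ ^ 2) 0 1) :
    f ∈ dirichletSpace ζ ∧ dirichletNormSq ζ f ≤ ENNReal.ofReal (5 * K) := by
  obtain ⟨g, hg, hsum⟩ := exists_lp_hasSum_of_norm_sum_sq_le hK hf
  have hhol : IsHol f := isHol_of_hasSum hsum
  have hcoeff : ∀ n, taylorCoeff f n = g (n + 1) - conj ζ * g n := taylorCoeff_of_hasSum hsum
  have hD := dirichletIntegral_le_of_taylorCoeff_eq hζ hhol hcoeff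
  refine ⟨⟨hhol, hD.trans_lt ENNReal.ofReal_lt_top⟩, ?_⟩
  refine (add_le_add (hardyNormSq_le_of_taylorCoeff_eq hζ hcoeff) hD).trans ?_
  rw [← ENNReal.ofReal_add (by positivity) (by positivity)]
  exact ENNReal.ofReal_le_ofReal (by linarith)

/-! ### Points outside the boundary spectrum -/

lemma eventually_lt_norm_of_notMem {b : ℂ → ℂ} {ζ : ℂ} (hζ : ‖ζ‖ = 1)
    (h : ζ ∉ boundarySpectrum b) {c : ℝ} (hc : c < 1) :
    ∀ᶠ z in 𝓝[ball 0 1] ζ, c < ‖b z‖ := by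
  have hliminf : 1 ≤ liminf (fun z => ‖b z‖ₑ) (𝓝[ball 0 1] ζ) :=
    not_lt.mp fun hlt => h ⟨hζ, hlt⟩
  have hc' : ENNReal.ofReal c < liminf (fun z => ‖b z‖ₑ) (𝓝[ball 0 1] ζ) :=
    (ENNReal.ofReal_lt_one.mpr hc).trans_le hliminf
  filter_upwards [eventually_lt_of_lt_liminf hc'] with z hz
  rw [← ofReal_norm] at hz
  exact (ENNReal.ofReal_lt_ofReal_iff'.mp hz).1

section NotMem

variable (b : SchurFunction) {ζ : ℂ} (hζ : ‖ζ‖ = 1) (h : ζ ∉ boundarySpectrum b)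
include hζ h

lemma tendsto_norm_radial_of_notMem :
    Tendsto (fun s : ℝ => ‖b (s * ζ)‖) (𝓝[<] 1) (𝓝 1) := by
  have hmem : ∀ᶠ s : ℝ in 𝓝[<] 1, (s : ℂ) * ζ ∈ ball (0 : ℂ) 1 := by
    filter_upwards [Ioo_mem_nhdsLT zero_lt_one] with s hs
    exact ofReal_mul_mem_ball hs.1.le hs.2 hζ.le
  have hradial : Tendsto (fun s : ℝ => (s : ℂ) * ζ) (𝓝[<] 1) (𝓝[ball 0 1] ζ) :=
    tendsto_nhdsWithin_iff.mpr ⟨tendsto_ofReal_mul ζ, hmem⟩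
  refine tendsto_order.mpr
    ⟨fun c hc => hradial.eventually (eventually_lt_norm_of_notMem hζ h hc), fun c hc => ?_⟩
  filter_upwards [hmem] with s hs
  exact (b.norm_apply_le hs).trans_lt hc

lemma exists_re_one_sub_le_of_notMem {ε : ℝ} (hε : 0 < ε)
    (hlim : ∀ᵐ θ : ℝ, ‖circleMap 0 1 θ - ζ‖ < ε →
      Tendsto (fun s : ℝ => ‖b (s * circleMap 0 1 θ)‖) (𝓝[<] 1) (𝓝 1)) :
    ∃ (β : ℂ) (C : ℝ), ‖β‖ = 1 ∧ 0 ≤ C ∧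
      ∀ z, ‖z‖ < 1 → (1 - β * b z).re ≤ C * (‖z - ζ‖ ^ 2 + (1 - ‖z‖)) := by
  obtain ⟨δ, hδ, hδb⟩ :=
    mem_nhdsWithin_iff.mp (eventually_lt_norm_of_notMem hζ h (show (1 / 2 : ℝ) < 1 by norm_num))
  set ρ := min (min ε δ) 1
  have hρ0 : 0 < ρ := lt_min (lt_min hε hδ) one_pos
  have hρε : ρ ≤ ε := (min_le_left _ _).trans (min_le_left _ _)
  have hρδ : ρ ≤ δ := (min_le_left _ _).trans (min_le_right _ _)
  have hbρ : ∀ w, ‖w‖ < 1 → ‖w - ζ‖ < ρ → 1 / 2 ≤ ‖b w‖ := fun w hw hwζ =>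
    (hδb ⟨mem_ball_iff_norm.mpr (hwζ.trans_le hρδ), mem_ball_zero_iff.mpr hw⟩).le
  exact exists_re_one_sub_le b hζ (by positivity) (by positivity) fun z =>
    one_sub_norm_le_of_unimodular b hζ hρ0 (min_le_right _ _) hbρ
      (hlim.mono fun θ hθ hθρ => hθ (hθρ.trans_le hρε))

lemma exists_dirichletNormSq_le_of_notMem {ε : ℝ} (hε : 0 < ε)
    (hlim : ∀ᵐ θ : ℝ, ‖circleMap 0 1 θ - ζ‖ < ε →
      Tendsto (fun s : ℝ => ‖b (s * circleMap 0 1 θ)‖) (𝓝[<] 1) (𝓝 1)) :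
    ∃ C : ℝ≥0, ∀ (f : ℂ → ℂ) (N : ℝ≥0),
      (∀ (s : Finset Complex.UnitDisc) (c : Complex.UnitDisc → ℂ),
        ‖∑ x ∈ s, conj (c x) * f x‖ ^ 2 ≤ N * dbrForm b s c) →
      f ∈ dirichletSpace ζ ∧ dirichletNormSq ζ f ≤ C * N := by
  obtain ⟨β, C, hβ, hC, hre⟩ := exists_re_one_sub_le_of_notMem b hζ h hε hlim
  refine ⟨(10 * C).toNNReal, fun f N hf => ?_⟩
  have hf' : ∀ (s : Finset Complex.UnitDisc) (c : Complex.UnitDisc → ℂ),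
      ‖∑ x ∈ s, conj (c x) * f x‖ ^ 2
        ≤ N * (2 * C) * Real.circleAverage (fun z => ‖(z - ζ) * szegoSum s c z‖ ^ 2) 0 1 :=
    fun s c => (hf s c).trans <| by
      rw [mul_assoc]
      exact mul_le_mul_of_nonneg_left (dbrForm_le_circleAverage s c b hζ hβ hC hre) N.2
  obtain ⟨hmem, hle⟩ := mem_dirichletSpace_of_norm_sum_sq_le hζ (by positivity) hf'
  refine ⟨hmem, hle.trans_eq ?_⟩
  rw [show 5 * (N * (2 * C)) = 10 * C * N by ring, ENNReal.ofReal_mul (by positivity),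
    ENNReal.ofReal_coe_nnreal, ENNReal.ofReal]

end NotMem

/-! ### The de Branges–Rovnyak space -/

lemma extendDisc_coe (f : Complex.UnitDisc → ℂ) (x : Complex.UnitDisc) :
    extendDisc f x = f x :=
  dif_pos x.norm_lt_one

lemma kerFun_apply_eq (b : SchurFunction) (w x : Complex.UnitDisc) :
    RKHS.kerFun (DeBrangesRovnyak b) w 1 x = dbrKernel b x w := by
  rw [RKHS.kerFun_apply, RKHS.OfKernel.kernel_ofKernel]
  simp [dbrMatrix]

lemma inner_kerFun_kerFun (b : SchurFunction) (x y : Complex.UnitDisc) :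
    inner ℂ (RKHS.kerFun (DeBrangesRovnyak b) x 1) (RKHS.kerFun (DeBrangesRovnyak b) y 1)
      = conj (dbrKernel b y x) := by
  rw [RKHS.inner_kerFun, kerFun_apply_eq]
  simp

lemma norm_sum_kerFun_sq (b : SchurFunction) (s : Finset Complex.UnitDisc)
    (c : Complex.UnitDisc → ℂ) :
    ‖∑ x ∈ s, c x • RKHS.kerFun (DeBrangesRovnyak b) x 1‖ ^ 2 = dbrForm b s c := by
  rw [← inner_self_eq_norm_sq (𝕜 := ℂ), dbrForm, ← Complex.conj_re, RCLike.re_to_complex]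
  simp only [sum_inner, inner_sum, inner_smul_left, inner_smul_right, inner_kerFun_kerFun,
    map_sum, map_mul, Complex.conj_conj, Finset.mul_sum]
  congr 1
  exact Finset.sum_comm.trans
    (Finset.sum_congr rfl fun x _ => Finset.sum_congr rfl fun y _ => by ring)

lemma norm_sum_conj_mul_extendDisc_sq_le (b : SchurFunction) (f : DeBrangesRovnyak b)
    (s : Finset Complex.UnitDisc) (c : Complex.UnitDisc → ℂ) :
    ‖∑ x ∈ s, conj (c x) * extendDisc f x‖ ^ 2 ≤ ‖f‖ ^ 2 * dbrForm b s c := by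
  have hinner : ∑ x ∈ s, conj (c x) * extendDisc f x
      = inner ℂ (∑ x ∈ s, c x • RKHS.kerFun (DeBrangesRovnyak b) x 1) f := by
    rw [sum_inner]
    refine Finset.sum_congr rfl fun x _ => ?_
    rw [inner_smul_left, RKHS.kerFun_inner, extendDisc_coe]
    simp
  rw [hinner, ← norm_sum_kerFun_sq, ← mul_pow, mul_comm]
  exact pow_le_pow_left₀ (norm_nonneg _) (norm_inner_le_norm _ _) 2

theorem deBrangesRovnyakEmbeds_of_notMem_closure {ζ : ℂ} (hζ : ‖ζ‖ = 1) (b : SchurFunction)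
    (h : ζ ∉ closure (boundarySpectrum b)) : DeBrangesRovnyakEmbeds b ζ := by
  obtain ⟨ε, hε, hball⟩ := isOpen_iff.mp isClosed_closure.isOpen_compl ζ h
  have hlim : ∀ θ : ℝ, ‖circleMap 0 1 θ - ζ‖ < ε →
      Tendsto (fun s : ℝ => ‖b (s * circleMap 0 1 θ)‖) (𝓝[<] 1) (𝓝 1) := fun θ hθ =>
    tendsto_norm_radial_of_notMem b (by simp)
      (notMem_of_notMem_closure (hball (mem_ball_iff_norm.mpr hθ)))
  obtain ⟨C, hC⟩ := exists_dirichletNormSq_le_of_notMem b hζ (notMem_of_notMem_closure h) hε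
    (.of_forall hlim)
  have hf := fun f : DeBrangesRovnyak b =>
    hC (extendDisc f) (‖f‖₊ ^ 2) (by simpa using norm_sum_conj_mul_extendDisc_sq_le b f)
  refine ⟨fun f => (hf f).1, C, fun f => (hf f).2.trans_eq ?_⟩
  rw [ENNReal.coe_pow]
  rfl

theorem notMem_of_deBrangesRovnyakEmbeds {ζ : ℂ} (hζ : ‖ζ‖ = 1) (b : SchurFunction)
    (h : DeBrangesRovnyakEmbeds b ζ) : ζ ∉ boundarySpectrum b := by
  obtain ⟨-, C, hC⟩ := h
  refine notMem_boundarySpectrum_of_kernel_bound hζ b C fun w hw => ?_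
  set x : Complex.UnitDisc := Complex.UnitDisc.mk w hw
  set k : DeBrangesRovnyak b := RKHS.kerFun (DeBrangesRovnyak b) x 1
  have hk : EqOn (fun z => dbrKernel b z w) (extendDisc k) (ball 0 1) := fun z hz => by
    have h := extendDisc_coe k (Complex.UnitDisc.mk z (mem_ball_zero_iff.mp hz))
    rw [kerFun_apply_eq] at h
    exact h.symm
  have hnorm : ‖k‖ₑ ^ 2 = ENNReal.ofReal ((1 - ‖b w‖ ^ 2) / (1 - ‖w‖ ^ 2)) := by
    rw [enorm_sq_eq_ofReal, ← inner_self_eq_norm_sq (𝕜 := ℂ), inner_kerFun_kerFun,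
      show (x : ℂ) = w from rfl, dbrKernel_self, Complex.conj_ofReal]
    rfl
  rw [dirichletIntegral_congr ζ hk, ← hnorm]
  exact le_add_self.trans (hC k)

/-! ### `H²` inside `ℓ²` -/

lemma memℓp_taylorCoeff {f : ℂ → ℂ} (hf : f ∈ hardySpace) : Memℓp (taylorCoeff f) 2 := by
  rw [memℓp_gen_iff (by norm_num)]
  simpa using summable_norm_sq_taylorCoeff hf.2

lemma mem_hardySpace_of_memℓp {f : ℂ → ℂ} (hf : IsHol f) (h : Memℓp (taylorCoeff f) 2) :
    f ∈ hardySpace := by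
  have hsummable : Summable fun n => ‖taylorCoeff f n‖ ^ 2 := by
    simpa using (memℓp_gen_iff (by norm_num)).mp h
  refine ⟨hf, ?_⟩
  rw [hardyNormSq, tsum_congr fun n => enorm_sq_eq_ofReal (taylorCoeff f n),
    ← ENNReal.ofReal_tsum_of_nonneg (fun _ => sq_nonneg _) hsummable]
  exact ENNReal.ofReal_lt_top

/-- A function in `H²` as an element of the Hilbert space `ℓ²`, through its Taylor
coefficients. -/
def hardyVec {f : ℂ → ℂ} (hf : f ∈ hardySpace) : lp (fun _ : ℕ => ℂ) 2 :=
  ⟨taylorCoeff f, memℓp_taylorCoeff hf⟩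

lemma hardyNormSq_eq_norm_hardyVec {f : ℂ → ℂ} (hf : f ∈ hardySpace) :
    hardyNormSq f = ENNReal.ofReal (‖hardyVec hf‖ ^ 2) := by
  rw [hardyNormSq_eq_ofReal hf.2, ← (hasSum_norm_sq_lp (hardyVec hf)).tsum_eq]
  rfl

lemma norm_hardyVec_le_of_hardyNormSq_le {f g : ℂ → ℂ} (hf : f ∈ hardySpace) (hg : g ∈ hardySpace)
    (h : hardyNormSq f ≤ hardyNormSq g) : ‖hardyVec hf‖ ≤ ‖hardyVec hg‖ := by
  rw [hardyNormSq_eq_norm_hardyVec hf, hardyNormSq_eq_norm_hardyVec hg,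
    ENNReal.ofReal_le_ofReal_iff (sq_nonneg _)] at h
  exact le_of_sq_le_sq h (norm_nonneg _)

lemma hardyInner_eq_inner {f g : ℂ → ℂ} (hf : f ∈ hardySpace) (hg : g ∈ hardySpace) :
    hardyInner f g = inner ℂ (hardyVec hg) (hardyVec hf) := by
  rw [lp.inner_eq_tsum]
  rfl

lemma taylorCoeff_add_mul {f g : ℂ → ℂ} (hf : IsHol f) (hg : IsHol g) (t : ℂ) (n : ℕ) :
    taylorCoeff (fun z => f z + t * g z) n = taylorCoeff f n + t * taylorCoeff g n := by
  refine taylorCoeff_of_hasSum (a := fun n => taylorCoeff f n + t * taylorCoeff g n)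
    (fun z hz => ?_) n
  refine ((hasSum_taylorCoeff hf hz).add ((hasSum_taylorCoeff hg hz).mul_left t)).congr_fun
    fun n => ?_
  ring

lemma add_mul_mem_hardySpace {f g : ℂ → ℂ} (hf : f ∈ hardySpace) (hg : g ∈ hardySpace) (t : ℂ) :
    (fun z => f z + t * g z) ∈ hardySpace := by
  refine mem_hardySpace_of_memℓp (DifferentiableOn.add hf.1 (DifferentiableOn.const_mul hg.1 t)) ?_
  have hcoeff : taylorCoeff (fun z => f z + t * g z) = taylorCoeff f + t • taylorCoeff g :=
    funext (taylorCoeff_add_mul hf.1 hg.1 t)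
  rw [hcoeff]
  exact (memℓp_taylorCoeff hf).add ((memℓp_taylorCoeff hg).const_smul t)

lemma hardyVec_add_mul {f g : ℂ → ℂ} (hf : f ∈ hardySpace) (hg : g ∈ hardySpace) (t : ℂ) :
    hardyVec (add_mul_mem_hardySpace hf hg t) = hardyVec hf + t • hardyVec hg :=
  lp.ext (funext (taylorCoeff_add_mul hf.1 hg.1 t))

/-! ### Radial limits and the norm of `H²` -/

lemma circleAverage_norm_sq_le_of_le {f : ℂ → ℂ} (hf : IsHol f) {r s : ℝ} (hr : 0 ≤ r)
    (hrs : r ≤ s) (hs : s < 1) :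
    Real.circleAverage (fun z => ‖f z‖ ^ 2) 0 r ≤ Real.circleAverage (fun z => ‖f z‖ ^ 2) 0 s :=
  hasSum_le (fun n => by gcongr) (hasSum_circleAverage_of_isHol hf hr (hrs.trans_lt hs))
    (hasSum_circleAverage_of_isHol hf (hr.trans hrs) hs)

lemma hardyNormSq_eq_of_tendsto {f : ℂ → ℂ} (hf : IsHol f) {L : ℝ}
    (h : Tendsto (fun r => Real.circleAverage (fun z => ‖f z‖ ^ 2) 0 r) (𝓝[<] 1) (𝓝 L)) :
    hardyNormSq f = ENNReal.ofReal L := by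
  have hle : hardyNormSq f ≤ ENNReal.ofReal L :=
    hardyNormSq_le_of_circleAverage_le hf fun r hr => ge_of_tendsto h <| by
      filter_upwards [Ioo_mem_nhdsLT hr.2] with s hs
      exact circleAverage_norm_sq_le_of_le hf hr.1.le hs.1.le hs.2
  have hmem : f ∈ hardySpace := ⟨hf, hle.trans_lt ENNReal.ofReal_lt_top⟩
  refine hle.antisymm ?_
  rw [hardyNormSq_eq_ofReal hmem.2]
  refine ENNReal.ofReal_le_ofReal (le_of_tendsto h ?_)
  filter_upwards [Ioo_mem_nhdsLT zero_lt_one] with r hr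
  exact circleAverage_le_tsum hmem hr.1.le hr.2

lemma circleAverage_eq_average_ofReal_mul (F : ℂ → ℝ) (r : ℝ) :
    Real.circleAverage F 0 r
      = (2 * π)⁻¹ • ∫ θ in (0 : ℝ)..2 * π, F (r * circleMap 0 1 θ) := by
  simp [Real.circleAverage, circleMap]

section Unimodular

variable {u : ℂ → ℂ} {M : ℝ} (hu : IsHol u) (hM : ∀ z ∈ ball (0 : ℂ) 1, ‖u z‖ ≤ M)
  (hlim : ∀ᵐ θ : ℝ, Tendsto (fun r : ℝ => ‖u (r * circleMap 0 1 θ)‖) (𝓝[<] 1) (𝓝 1))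
include hu hM hlim

lemma tendsto_circleAverage_norm_mul_sq {G : ℂ → ℂ} (hG : ContinuousOn G (closedBall 0 1)) :
    Tendsto (fun r : ℝ => Real.circleAverage (fun z => ‖u z * G z‖ ^ 2) 0 r) (𝓝[<] 1)
      (𝓝 (Real.circleAverage (fun z => ‖G z‖ ^ 2) 0 1)) := by
  obtain ⟨K, hK⟩ := (isCompact_closedBall (0 : ℂ) 1).exists_bound_of_continuousOn hG
  have hM0 : 0 ≤ M := (norm_nonneg _).trans (hM 0 (by simp))
  have hmem : ∀ᶠ r : ℝ in 𝓝[<] 1, ∀ θ, (r : ℂ) * circleMap 0 1 θ ∈ ball (0 : ℂ) 1 := by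
    filter_upwards [Ioo_mem_nhdsLT zero_lt_one] with r hr θ
    exact ofReal_mul_mem_ball hr.1.le hr.2 (by simp)
  simp only [circleAverage_eq_average_ofReal_mul, Complex.ofReal_one, one_mul]
  refine Tendsto.const_smul (intervalIntegral.tendsto_integral_filter_of_dominated_convergence
    (fun _ => (M * K) ^ 2) ?_ ?_ (by simp) ?_) _
  · filter_upwards [hmem] with r hr
    have hu_cont : Continuous fun θ => u (r * circleMap 0 1 θ) :=
      hu.continuousOn.comp_continuous (by fun_prop) hr
    have hG_cont : Continuous fun θ => G (r * circleMap 0 1 θ) :=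
      hG.comp_continuous (by fun_prop) fun θ => ball_subset_closedBall (hr θ)
    exact ((hu_cont.mul hG_cont).norm.pow 2).aestronglyMeasurable
  · filter_upwards [hmem] with r hr
    refine .of_forall fun θ _ => ?_
    rw [norm_pow, norm_norm, norm_mul]
    exact pow_le_pow_left₀ (by positivity)
      (mul_le_mul (hM _ (hr θ)) (hK _ (ball_subset_closedBall (hr θ))) (norm_nonneg _) hM0) 2
  · filter_upwards [hlim] with θ hθ _
    have hradial : Tendsto (fun r : ℝ => (r : ℂ) * circleMap 0 1 θ) (𝓝[<] 1)
        (𝓝[closedBall 0 1] (circleMap 0 1 θ)) :=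
      tendsto_nhdsWithin_iff.mpr
        ⟨tendsto_ofReal_mul _, hmem.mono fun r hr => ball_subset_closedBall (hr θ)⟩
    have hGθ := (hG (circleMap 0 1 θ) (by simp)).tendsto.comp hradial
    simpa only [norm_mul, one_mul, Function.comp_def] using (hθ.mul hGθ.norm).pow 2

lemma hardyNormSq_mul_eq_circleAverage {G : ℂ → ℂ} (hG : DiffContOnCl ℂ G (ball 0 1)) :
    hardyNormSq (fun z => u z * G z)
      = ENNReal.ofReal (Real.circleAverage (fun z => ‖G z‖ ^ 2) 0 1) :=
  hardyNormSq_eq_of_tendsto (DifferentiableOn.mul hu hG.differentiableOn)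
    (tendsto_circleAverage_norm_mul_sq hu hM hlim hG.continuousOn_ball)

end Unimodular

lemma hardyNormSq_eq_circleAverage {G : ℂ → ℂ} (hG : DiffContOnCl ℂ G (ball 0 1)) :
    hardyNormSq G = ENNReal.ofReal (Real.circleAverage (fun z => ‖G z‖ ^ 2) 0 1) := by
  simpa only [one_mul] using hardyNormSq_mul_eq_circleAverage (u := fun _ => 1) (M := 1)
    (differentiableOn_const _) (by simp) (.of_forall fun _ => by simp) hG

lemma IsInner.exists_bound {u : ℂ → ℂ} (hu : IsInner u) :
    ∃ M : ℝ, ∀ z ∈ ball (0 : ℂ) 1, ‖u z‖ ≤ M := by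
  refine ⟨(hInftyNorm u).toReal, fun z hz => ?_⟩
  have h : ‖u z‖ₑ ≤ hInftyNorm u := le_iSup₂_of_le (f := fun z _ => ‖u z‖ₑ) z hz le_rfl
  simpa using ENNReal.toReal_mono hu.bounded.ne h

lemma IsInner.tendsto_norm {u : ℂ → ℂ} (hu : IsInner u) :
    ∀ᵐ θ : ℝ, Tendsto (fun r : ℝ => ‖u (r * circleMap 0 1 θ)‖) (𝓝[<] 1) (𝓝 1) := by
  filter_upwards [hu.unimodular] with θ ⟨l, hl, h⟩
  simpa [circleMap, hl] using h.norm

lemma IsInner.hardyNormSq_mul {u G : ℂ → ℂ} (hu : IsInner u) (hG : DiffContOnCl ℂ G (ball 0 1)) :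
    hardyNormSq (fun z => u z * G z) = hardyNormSq G := by
  obtain ⟨M, hM⟩ := hu.exists_bound
  rw [hardyNormSq_mul_eq_circleAverage hu.isHol hM hu.tendsto_norm hG,
    hardyNormSq_eq_circleAverage hG]

/-! ### Szegő kernels in `H²` -/

section SzegoSum

variable (s : Finset Complex.UnitDisc) (a : Complex.UnitDisc → ℂ)

lemma szegoSum_mem_hardySpace : szegoSum s a ∈ hardySpace :=
  ⟨(diffContOnCl_szegoSum s a).differentiableOn,
    (hardyNormSq_eq_circleAverage (diffContOnCl_szegoSum s a)).trans_lt ENNReal.ofReal_lt_top⟩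

lemma taylorCoeff_szegoSum (n : ℕ) :
    taylorCoeff (szegoSum s a) n = ∑ x ∈ s, a x * conj (x : ℂ) ^ n := by
  refine taylorCoeff_of_hasSum (a := fun n => ∑ x ∈ s, a x * conj (x : ℂ) ^ n) (fun z hz => ?_) n
  have hsum : HasSum (fun n => ∑ x ∈ s, a x * (conj (x : ℂ) * z) ^ n)
      (∑ x ∈ s, a x * (1 - conj (x : ℂ) * z)⁻¹) :=
    hasSum_sum fun x _ => (hasSum_geometric_of_norm_lt_one
      (norm_conj_mul_lt_one x (mem_ball_zero_iff.mp hz).le)).mul_left _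
  refine hsum.congr_fun fun n => ?_
  rw [Finset.sum_mul]
  exact Finset.sum_congr rfl fun x _ => by ring

lemma inner_hardyVec_szegoSum {f : ℂ → ℂ} (hf : f ∈ hardySpace) :
    inner ℂ (hardyVec (szegoSum_mem_hardySpace s a)) (hardyVec hf)
      = ∑ x ∈ s, conj (a x) * f x := by
  have hsum : HasSum (fun n => ∑ x ∈ s, conj (a x) * (taylorCoeff f n * (x : ℂ) ^ n))
      (∑ x ∈ s, conj (a x) * f x) :=
    hasSum_sum fun x _ =>
      (hasSum_taylorCoeff hf.1 (mem_ball_zero_iff.mpr x.norm_lt_one)).mul_left _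
  rw [← hardyInner_eq_inner, ← hsum.tsum_eq]
  refine tsum_congr fun n => ?_
  rw [taylorCoeff_szegoSum, map_sum, Finset.mul_sum]
  refine Finset.sum_congr rfl fun x _ => ?_
  simp only [map_mul, map_pow, Complex.conj_conj]
  ring

end SzegoSum

/-! ### Multiplication by inner functions -/

/-- `|u(w)| ‖k_w‖² = |⟪k_w, u k_w⟫| ≤ ‖k_w‖ ‖u k_w‖ = ‖k_w‖²` -/
lemma IsInner.norm_apply_le_one {u : ℂ → ℂ} (hu : IsInner u) (w : Complex.UnitDisc) :
    ‖u w‖ ≤ 1 := by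
  have hkc := diffContOnCl_szegoSum {w} fun _ => 1
  have hk := szegoSum_mem_hardySpace {w} fun _ => 1
  set k := szegoSum {w} fun _ => 1
  have hnorm : hardyNormSq (fun z => u z * k z) = hardyNormSq k := hu.hardyNormSq_mul hkc
  have huk : (fun z => u z * k z) ∈ hardySpace :=
    ⟨DifferentiableOn.mul hu.isHol hkc.differentiableOn, hnorm.trans_lt hk.2⟩
  have heval : ∀ {f : ℂ → ℂ} (hf : f ∈ hardySpace), inner ℂ (hardyVec hk) (hardyVec hf) = f w :=
    fun hf => by simpa using inner_hardyVec_szegoSum {w} (fun _ => 1) hf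
  have hkw : k w = ((‖hardyVec hk‖ ^ 2 : ℝ) : ℂ) := by
    rw [← heval hk, inner_self_eq_norm_sq_to_K]
    norm_cast
  have hkw0 : k w ≠ 0 := by
    have hne := one_sub_conj_mul_ne_zero w.norm_lt_one w.norm_lt_one.le
    simpa [k, szegoSum] using hne
  have hpos : 0 < ‖hardyVec hk‖ ^ 2 :=
    (sq_nonneg _).lt_of_ne fun h => hkw0 (by rw [hkw, ← h, Complex.ofReal_zero])
  have hle : ‖u w‖ * ‖hardyVec hk‖ ^ 2 ≤ 1 * ‖hardyVec hk‖ ^ 2 := calc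
    ‖u w‖ * ‖hardyVec hk‖ ^ 2 = ‖inner ℂ (hardyVec hk) (hardyVec huk)‖ := by
      rw [heval huk, norm_mul, hkw, Complex.norm_real, Real.norm_of_nonneg (sq_nonneg _)]
    _ ≤ ‖hardyVec hk‖ * ‖hardyVec huk‖ := norm_inner_le_norm _ _
    _ ≤ ‖hardyVec hk‖ * ‖hardyVec hk‖ := by
      gcongr
      exact norm_hardyVec_le_of_hardyNormSq_le huk hk hnorm.le
    _ = 1 * ‖hardyVec hk‖ ^ 2 := by ring
  exact le_of_mul_le_mul_right hle hpos

/-- An inner function as an element of the Schur class. -/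
def IsInner.toSchur {u : ℂ → ℂ} (hu : IsInner u) : SchurFunction where
  toFun := u
  isHol := hu.isHol
  norm_le := iSup₂_le fun z hz => by
    rw [← ofReal_norm, ← ENNReal.ofReal_one]
    exact ENNReal.ofReal_le_ofReal
      (hu.norm_apply_le_one (Complex.UnitDisc.mk z (mem_ball_zero_iff.mp hz)))

lemma hardyNormSq_mul_le (u : SchurFunction) {h : ℂ → ℂ} (hh : h ∈ hardySpace) :
    hardyNormSq (fun z => u z * h z) ≤ hardyNormSq h := by
  have hhol : IsHol fun z => u z * h z := DifferentiableOn.mul u.isHol hh.1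
  rw [hardyNormSq_eq_ofReal hh.2]
  refine hardyNormSq_le_of_circleAverage_le hhol fun r hr =>
    le_trans ?_ (circleAverage_le_tsum hh hr.1.le hr.2)
  refine Real.circleAverage_mono
    (((hhol.continuousOn_sphere hr.2).norm.pow 2).circleIntegrable hr.1.le)
    (((hh.1.continuousOn_sphere hr.2).norm.pow 2).circleIntegrable hr.1.le) fun z hz => ?_
  rw [abs_of_pos hr.1, mem_sphere_zero_iff_norm] at hz
  have hu : ‖u z‖ ≤ 1 := u.norm_apply_le' (hz.trans_lt hr.2)
  rw [norm_mul]
  exact pow_le_pow_left₀ (by positivity) (mul_le_of_le_one_left (norm_nonneg _) hu) 2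

lemma mul_mem_hardySpace (u : SchurFunction) {h : ℂ → ℂ} (hh : h ∈ hardySpace) :
    (fun z => u z * h z) ∈ hardySpace :=
  ⟨DifferentiableOn.mul u.isHol hh.1, (hardyNormSq_mul_le u hh).trans_lt hh.2⟩

/-- The first-order term in `t` of `‖g' + t • h'‖² ≤ ‖g + t • h‖²` vanishes. -/
lemma inner_eq_of_norm_add_smul_le {E F : Type*} [NormedAddCommGroup E] [InnerProductSpace ℂ E]
    [NormedAddCommGroup F] [InnerProductSpace ℂ F] {g h : E} {g' h' : F}
    (hle : ∀ t : ℂ, ‖g' + t • h'‖ ≤ ‖g + t • h‖) (hg : ‖g‖ ≤ ‖g'‖) :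
    (inner ℂ g' h' : ℂ) = inner ℂ g h := by
  set D : ℂ := inner ℂ g' h' - inner ℂ g h with hD
  have hlinear : ∀ t : ℂ, 2 * (t * D).re ≤ ‖t‖ ^ 2 * ‖h‖ ^ 2 := by
    intro t
    have hsq := pow_le_pow_left₀ (norm_nonneg _) (hle t) 2
    rw [norm_add_sq (𝕜 := ℂ), norm_add_sq (𝕜 := ℂ), inner_smul_right, inner_smul_right, norm_smul,
      norm_smul, mul_pow, mul_pow, RCLike.re_to_complex, RCLike.re_to_complex] at hsq
    have hgsq := pow_le_pow_left₀ (norm_nonneg _) hg 2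
    have hh' : 0 ≤ ‖t‖ ^ 2 * ‖h'‖ ^ 2 := by positivity
    rw [hD, mul_sub, Complex.sub_re]
    linarith
  set e : ℝ := 1 / (‖h‖ ^ 2 + 1)
  have he0 : 0 < e := by positivity
  have he1 : e * ‖h‖ ^ 2 ≤ 1 := by
    rw [one_div_mul_eq_div, div_le_one (by positivity)]
    linarith
  have hre : ((e : ℂ) * conj D * D).re = e * ‖D‖ ^ 2 := by
    rw [mul_assoc, Complex.conj_mul', ← Complex.ofReal_pow, ← Complex.ofReal_mul,
      Complex.ofReal_re]
  have hlt := hlinear (e * conj D)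
  rw [hre, norm_mul, Complex.norm_real, Real.norm_of_nonneg he0.le, RCLike.norm_conj] at hlt
  have hmul : 0 ≤ e * ‖D‖ ^ 2 * (1 - e * ‖h‖ ^ 2) := mul_nonneg (by positivity) (by linarith)
  have hD0 : ‖D‖ ^ 2 ≤ 0 := nonpos_of_mul_nonpos_right (by linarith) he0
  exact sub_eq_zero.mp (norm_eq_zero.mp (pow_eq_zero_iff two_ne_zero |>.mp
    (hD0.antisymm (sq_nonneg _))))

lemma IsInner.inner_hardyVec_mul {u g h : ℂ → ℂ} (hu : IsInner u)
    (hgc : DiffContOnCl ℂ g (ball 0 1)) (hg : g ∈ hardySpace) (hh : h ∈ hardySpace) :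
    (inner ℂ (hardyVec (mul_mem_hardySpace hu.toSchur hg))
        (hardyVec (mul_mem_hardySpace hu.toSchur hh)) : ℂ)
      = inner ℂ (hardyVec hg) (hardyVec hh) := by
  refine inner_eq_of_norm_add_smul_le (fun t => ?_)
    (norm_hardyVec_le_of_hardyNormSq_le _ _ (hu.hardyNormSq_mul hgc).ge)
  rw [← hardyVec_add_mul, ← hardyVec_add_mul]
  have hmul : (fun z => hu.toSchur z * g z + t * (hu.toSchur z * h z))
      = fun z => hu.toSchur z * (g z + t * h z) := by
    ext z
    ring
  exact norm_hardyVec_le_of_hardyNormSq_le _ _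
    (hmul ▸ hardyNormSq_mul_le hu.toSchur (add_mul_mem_hardySpace hg hh t))

/-! ### The model space -/

/-- The combination `∑ c_x k^u(·, x)` of reproducing kernels of `H(u)`; for `u` inner these are the
reproducing kernels of `K_u`. -/
def dbrSum (u : ℂ → ℂ) (s : Finset Complex.UnitDisc) (c : Complex.UnitDisc → ℂ) (z : ℂ) : ℂ :=
  ∑ x ∈ s, c x * dbrKernel u z x

lemma dbrSum_eq (u : ℂ → ℂ) (s : Finset Complex.UnitDisc) (c : Complex.UnitDisc → ℂ) :
    dbrSum u s c
      = fun z => szegoSum s c z + (-1) * (u z * szegoSum s (fun x => c x * conj (u x)) z) := by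
  ext z
  rw [dbrSum, szegoSum, szegoSum, Finset.mul_sum, Finset.mul_sum, ← Finset.sum_add_distrib]
  refine Finset.sum_congr rfl fun x _ => ?_
  rw [dbrKernel]
  ring

lemma modelSpace_subset_hardySpace (u : ℂ → ℂ) : modelSpace u ⊆ hardySpace := fun _ hf => hf.1

section ModelSpace

variable (u : SchurFunction) (s : Finset Complex.UnitDisc) (c : Complex.UnitDisc → ℂ)

lemma dbrSum_mem_hardySpace : dbrSum u s c ∈ hardySpace := by
  rw [dbrSum_eq]
  exact add_mul_mem_hardySpace (szegoSum_mem_hardySpace s c)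
    (mul_mem_hardySpace u (szegoSum_mem_hardySpace s _)) (-1)

lemma hardyVec_dbrSum :
    hardyVec (dbrSum_mem_hardySpace u s c)
      = hardyVec (szegoSum_mem_hardySpace s c) - hardyVec (mul_mem_hardySpace u
          (szegoSum_mem_hardySpace s fun x => c x * conj (u x))) := by
  rw [sub_eq_add_neg, ← neg_one_smul ℂ (hardyVec _), ← hardyVec_add_mul]
  congr 1
  exact dbrSum_eq u s c

lemma inner_hardyVec_dbrSum {f : ℂ → ℂ} (hf : f ∈ modelSpace u) :
    inner ℂ (hardyVec (dbrSum_mem_hardySpace u s c)) (hardyVec (modelSpace_subset_hardySpace u hf))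
      = ∑ x ∈ s, conj (c x) * f x := by
  rw [hardyVec_dbrSum, inner_sub_left, inner_hardyVec_szegoSum, ← hardyInner_eq_inner,
    hf.2 _ (szegoSum_mem_hardySpace s _), sub_zero]

end ModelSpace

namespace IsInner

variable {u : ℂ → ℂ} (hu : IsInner u) (s : Finset Complex.UnitDisc) (c : Complex.UnitDisc → ℂ)
include hu

lemma dbrSum_mem_modelSpace : dbrSum u s c ∈ modelSpace u := by
  refine ⟨dbrSum_mem_hardySpace hu.toSchur s c, fun h hh => ?_⟩
  have horth : (inner ℂ (hardyVec (dbrSum_mem_hardySpace hu.toSchur s c))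
      (hardyVec (mul_mem_hardySpace hu.toSchur hh)) : ℂ) = 0 := by
    rw [hardyVec_dbrSum, inner_sub_left, inner_hardyVec_szegoSum,
      hu.inner_hardyVec_mul (diffContOnCl_szegoSum s _) (szegoSum_mem_hardySpace s _) hh,
      inner_hardyVec_szegoSum, sub_eq_zero]
    refine Finset.sum_congr rfl fun x _ => ?_
    rw [map_mul, Complex.conj_conj, mul_assoc]
  exact (hardyInner_eq_inner _ _).trans (inner_eq_zero_symm.mp horth)

lemma norm_hardyVec_dbrSum_sq :
    ‖hardyVec (dbrSum_mem_hardySpace hu.toSchur s c)‖ ^ 2 = dbrForm u s c := by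
  have hinner := inner_hardyVec_dbrSum hu.toSchur s c (hu.dbrSum_mem_modelSpace s c)
  rw [← inner_self_eq_norm_sq (𝕜 := ℂ)]
  refine (congrArg Complex.re hinner).trans ?_
  rw [dbrForm, Finset.sum_comm]
  congr 1
  refine Finset.sum_congr rfl fun x _ => ?_
  rw [dbrSum, Finset.mul_sum]
  exact Finset.sum_congr rfl fun y _ => by ring

lemma norm_sum_conj_mul_sq_le {f : ℂ → ℂ} (hf : f ∈ modelSpace u) :
    ‖∑ x ∈ s, conj (c x) * f x‖ ^ 2
      ≤ ‖hardyVec (modelSpace_subset_hardySpace u hf)‖ ^ 2 * dbrForm u s c := by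
  rw [← hu.norm_hardyVec_dbrSum_sq, ← mul_pow, mul_comm, ← inner_hardyVec_dbrSum hu.toSchur s c hf]
  exact pow_le_pow_left₀ (norm_nonneg _) (norm_inner_le_norm _ _) 2

end IsInner

theorem modelSpaceEmbeds_of_notMem {ζ : ℂ} (hζ : ‖ζ‖ = 1) {u : ℂ → ℂ} (hu : IsInner u)
    (h : ζ ∉ boundarySpectrum u) : ModelSpaceEmbeds u ζ := by
  obtain ⟨C, hC⟩ := exists_dirichletNormSq_le_of_notMem hu.toSchur hζ h one_pos
    (hu.tendsto_norm.mono fun θ hθ _ => hθ)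
  have hf := fun f : modelSpace u => hC f (‖hardyVec (modelSpace_subset_hardySpace u f.2)‖₊ ^ 2)
    fun s c => by
      rw [NNReal.coe_pow, coe_nnnorm]
      exact hu.norm_sum_conj_mul_sq_le s c f.2
  refine ⟨fun f => (hf f).1, C, fun f => (hf f).2.trans_eq ?_⟩
  beta_reduce
  rw [hardyNormSq_eq_norm_hardyVec (modelSpace_subset_hardySpace u f.2), ← enorm_sq_eq_ofReal,
    ENNReal.coe_pow]
  rfl

theorem notMem_of_modelSpaceEmbeds {ζ : ℂ} (hζ : ‖ζ‖ = 1) {u : ℂ → ℂ} (hu : IsInner u)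
    (h : ModelSpaceEmbeds u ζ) : ζ ∉ boundarySpectrum u := by
  obtain ⟨-, C, hC⟩ := h
  refine notMem_boundarySpectrum_of_kernel_bound hζ hu.toSchur C fun w hw => ?_
  set x : Complex.UnitDisc := Complex.UnitDisc.mk w hw
  have hk := hu.dbrSum_mem_modelSpace {x} fun _ => 1
  have hsum : (fun z => dbrKernel hu.toSchur z w) = dbrSum u {x} fun _ => 1 := by
    ext z
    rw [dbrSum, Finset.sum_singleton, one_mul]
    rfl
  have hform : dbrForm u {x} (fun _ => 1) = (1 - ‖hu.toSchur w‖ ^ 2) / (1 - ‖w‖ ^ 2) := by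
    rw [dbrForm, Finset.sum_singleton, Finset.sum_singleton, map_one, mul_one, mul_one]
    exact (congrArg Complex.re (dbrKernel_self hu.toSchur w)).trans (Complex.ofReal_re _)
  rw [hsum, ← hform, ← hu.norm_hardyVec_dbrSum_sq, ← hardyNormSq_eq_norm_hardyVec]
  exact le_add_self.trans (hC ⟨_, hk⟩)

end LocalDirichlet

end

theorem corollary4p1_general (ζ : ℂ) (hζ : ‖ζ‖ = 1) :
    (∀ b : LocalDirichlet.SchurFunction,
      (ζ ∈ closure (LocalDirichlet.boundarySpectrum b) → ζ ∈ LocalDirichlet.boundarySpectrum b) →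
      (LocalDirichlet.DeBrangesRovnyakEmbeds b ζ ↔ ζ ∉ LocalDirichlet.boundarySpectrum b)) ∧
    (∀ u : ℂ → ℂ, LocalDirichlet.IsInner u →
      (LocalDirichlet.ModelSpaceEmbeds u ζ ↔ ζ ∉ LocalDirichlet.boundarySpectrum u)) :=
  ⟨fun b hb => ⟨LocalDirichlet.notMem_of_deBrangesRovnyakEmbeds hζ b,
      fun h => LocalDirichlet.deBrangesRovnyakEmbeds_of_notMem_closure hζ b (mt hb h)⟩,
    fun _ hu => ⟨LocalDirichlet.notMem_of_modelSpaceEmbeds hζ hu,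
      LocalDirichlet.modelSpaceEmbeds_of_notMem hζ hu⟩⟩

theorem corollary4p1 (ζ : ℂ) (hζ : ‖ζ‖ = 1) :
    (∀ b : LocalDirichlet.SchurFunction,
      LocalDirichlet.hInftyNorm b = 1 →
      IsClosed (LocalDirichlet.boundarySpectrum b) →
      (LocalDirichlet.DeBrangesRovnyakEmbeds b ζ ↔ ζ ∉ LocalDirichlet.boundarySpectrum b)) ∧
    (∀ u : ℂ → ℂ, LocalDirichlet.IsInner u →
      (LocalDirichlet.ModelSpaceEmbeds u ζ ↔ ζ ∉ LocalDirichlet.boundarySpectrum u)) :=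
  ⟨fun b _ hcl => (corollary4p1_general ζ hζ).1 b fun h => hcl.closure_eq ▸ h,
    (corollary4p1_general ζ hζ).2⟩
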